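/- Let $0<\alpha<\delta$ be real numbers and let $x_0,y_0\ge 0$ with $x_0+y_0>0$. Let $(X(t),Y(t))_{t\ge 0}$ be the continuous-time random walk in the plane started at $(X(0),Y(0))=(x_0,y_0)$ with the balanced upper-triangular navigation matrix $$A=\begin{pmatrix}\alpha & \delta-\alpha\\ 0 & \delta\end{pmatrix}.$$ That is: whenever the walk is at $(x,y)$, the waiting time until the next renewal is exponential with rate $x+y$ and, independently of the waiting time, the renewal is of type $1$ with probability $x/(x+y)$, in which case the walk jumps to $(x+\alpha,\,y+\delta-\alpha)$, and of type $2$ with probability $y/(x+y)$, in which case it jumps to $(x,\,y+\delta)$; given the present position, the waiting time and type of the next renewal do not depend on the past; between renewals the walk does not move. Let $t\ge 0$. For all real $u,v$ such that $$e^{-\delta v}-1+e^{-\delta t}>0\quad\text{and}\quad e^{-\alpha u}-e^{-\alpha v}+\bigl(e^{-\delta v}-1+e^{-\delta t}\bigr)^{\alpha/\delta}>0$$ (this holds in particular for all $(u,v)$ in a neighbourhood of $(0,0)$), the random variable $e^{uX(t)+vY(t)}$ is integrable, and the joint moment generating function is $$\mathbb E\,e^{uX(t)+vY(t)}=e^{-x_0t}\Bigl(e^{-\alpha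 u}-e^{-\alpha v}+\bigl(e^{-\delta v}-1+e^{-\delta t}\bigr)^{\alpha/\delta}\Bigr)^{-x_0/\alpha}\cdot e^{-y_0t}\bigl(e^{-\delta v}-1+e^{-\delta t}\bigr)^{-y_0/\delta}.$$ Moreover $X(t)$ and $Y(t)$ are square-integrable, and their first and second moments are $$\begin{aligned} \mathbb E X(t)&=x_0e^{\alpha t},\\ \mathbb E Y(t)&=(x_0+y_0)e^{\delta t}-x_0e^{\alpha t},\\ \mathbb E X(t)^2&=x_0(\alpha+x_0)e^{2\alpha t}-\alpha x_0e^{\alpha t},\\ \mathbb E X(t)Y(t)&=x_0(\alpha+x_0+y_0)e^{(\alpha+\delta)t}-x_0(\alpha+x_0)e^{2\alpha t},\\ \mathbb E Y(t)^2&=(x_0+y_0)(\delta+x_0+y_0)e^{2\delta t}-2x_0(\alpha+x_0+y_0)e^{(\alpha+\delta)t}-\delta(x_0+y_0)e^{\delta t}+x_0(\alpha+x_0)e^{2\alpha t}+\alpha x_0e^{\alpha t}. \end{aligned}$$ -/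

import Mathlib

open MeasureTheory ProbabilityTheory

/-- The law of the waiting time until the next renewal when the walk sits at `z`: exponential with
rate `∑ i, z i`. -/
noncomputable def waitingTimeKernel (c : ℕ) : Kernel (Fin c → ℝ) ℝ where
  toFun z := expMeasure (∑ i, z i)
  measurable' := by
    have h : Measurable (Function.uncurry fun (z : Fin c → ℝ) (x : ℝ) =>
        exponentialPDF (∑ i, z i) x) := by
      have : (Function.uncurry fun (z : Fin c → ℝ) (x : ℝ) => exponentialPDF (∑ i, z i) x)
          = fun p : (Fin c → ℝ) × ℝ => ENNReal.ofReal
            (if 0 ≤ p.2 then (∑ i, p.1 i) * Real.exp (-((∑ i, p.1 i) * p.2)) else 0) := by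
        funext p
        simp [Function.uncurry, exponentialPDF_eq]
      rw [this]
      refine ENNReal.measurable_ofReal.comp (Measurable.ite ?_ ?_ measurable_const)
      · exact measurableSet_le measurable_const measurable_snd
      · fun_prop
    exact measurable_withDensity h

/-- The law of the colour of the next renewal when the walk sits at `z`: colour `i` has
probability `z i / ∑ j, z j`. -/
noncomputable def colourKernel (c : ℕ) : Kernel (Fin c → ℝ) (Fin c) where
  toFun z := ∑ i, ENNReal.ofReal (z i / ∑ j, z j) • Measure.dirac i
  measurable' := by
    refine Measure.measurable_of_measurable_coe _ fun s _ => ?_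
    simp only [Measure.finsetSum_apply, Measure.smul_apply, smul_eq_mul]
    fun_prop

theorem exponential_mass_le_one (r : ℝ) : expMeasure r Set.univ ≤ 1 := by
  by_cases hr : 0 < r
  · have := isProbabilityMeasure_expMeasure hr
    exact prob_le_one
  · have h0 : exponentialPDF r = fun _ => 0 := by
      funext x
      rw [exponentialPDF_eq]
      split_ifs
      · exact ENNReal.ofReal_eq_zero.2
          (mul_nonpos_of_nonpos_of_nonneg (not_lt.1 hr) (Real.exp_pos _).le)
      · simp
    change (volume.withDensity (exponentialPDF r)) Set.univ ≤ 1
    rw [h0]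
    simp

instance waitingTimeKernel_isFinite (c : ℕ) : IsFiniteKernel (waitingTimeKernel c) :=
  ⟨⟨1, ENNReal.one_lt_top, fun _ => exponential_mass_le_one _⟩⟩

instance colourKernel_isSFinite (c : ℕ) : IsSFiniteKernel (colourKernel c) := by
  have hm : Measurable (Function.uncurry fun (z : Fin c → ℝ) (i : Fin c) =>
      ENNReal.ofReal (z i / ∑ j, z j)) :=
    measurable_from_prod_countable_left fun i => by
      simp only [Function.uncurry]
      fun_prop
  have h : colourKernel c = Kernel.withDensity (Kernel.const _ Measure.count)
      (fun z i => ENNReal.ofReal (z i / ∑ j, z j)) := by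
    ext z s hs
    rw [Kernel.withDensity_apply' _ hm, Kernel.const_apply, ← lintegral_indicator hs,
      lintegral_count, tsum_fintype]
    change (∑ i, ENNReal.ofReal (z i / ∑ j, z j) • Measure.dirac i : Measure (Fin c)) s = _
    simp only [Measure.finsetSum_apply, Measure.smul_apply, smul_eq_mul,
      Measure.dirac_apply' _ hs]
    refine Finset.sum_congr rfl fun i _ => ?_
    by_cases hi : i ∈ s <;> simp [hi]
  rw [h]
  exact Kernel.IsSFiniteKernel.withDensity _ fun _ _ => ENNReal.ofReal_ne_top

/-- The joint law of the waiting time and the colour of the next renewal at position `z`: they are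
independent of each other. -/
noncomputable def renewalKernel (c : ℕ) : Kernel (Fin c → ℝ) (ℝ × Fin c) :=
  waitingTimeKernel c ×ₖ colourKernel c

/-- The position reached from `x₀` after `n` renewals of colours `J 0, …, J (n - 1)`: a renewal of
colour `i` adds the `i`-th row of the navigation matrix `A`. -/
def walkPosition {c : ℕ} (A : Matrix (Fin c) (Fin c) ℝ) (x₀ : Fin c → ℝ) {n : ℕ}
    (J : Fin n → Fin c) : Fin c → ℝ :=
  x₀ + ∑ k, A (J k)

theorem measurable_walkPosition {c : ℕ} (A : Matrix (Fin c) (Fin c) ℝ) (x₀ : Fin c → ℝ) (n : ℕ) :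
    Measurable fun h : Fin n → ℝ × Fin c => walkPosition A x₀ fun k => (h k).2 := by
  have hm : Measurable fun h : Fin n → ℝ × Fin c => fun k => (h k).2 := by fun_prop
  exact (Measurable.of_discrete (f := fun J : Fin n → Fin c => walkPosition A x₀ J)).comp hm

/-- The continuous-time process `W` on `(Ω, P)` is a walk with (deterministic) navigation matrix `A`
started at `x₀`.  There are waiting times `τ 0, τ 1, …` between consecutive renewals and colours
`J 0, J 1, …` of the renewals such that, given the first `n` waiting times and colours, the next
waiting time is exponential with rate the coordinate sum of the current position, and, independently
of it, the next colour is chosen with probability proportional to the coordinates of the current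
position; and from the `n`-th renewal up to the next one, `W` stays at the position reached after
`n` renewals. -/
def IsContinuumPolyaWalk {c : ℕ} {Ω : Type*} [MeasurableSpace Ω]
    (A : Matrix (Fin c) (Fin c) ℝ) (x₀ : Fin c → ℝ) (W : ℝ → Ω → Fin c → ℝ) (P : Measure Ω) :
    Prop :=
  ∃ (τ : ℕ → Ω → ℝ) (J : ℕ → Ω → Fin c),
    (∀ n, HasCondDistrib (fun ω => (τ n ω, J n ω)) (fun ω (k : Fin n) => (τ k ω, J k ω))
      ((renewalKernel c).comap (fun h => walkPosition A x₀ fun k => (h k).2)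
        (measurable_walkPosition A x₀ n)) P) ∧
    ∀ᵐ ω ∂P, ∀ (n : ℕ) (t : ℝ),
      ∑ k ∈ Finset.range n, τ k ω ≤ t → t < ∑ k ∈ Finset.range (n + 1), τ k ω →
        W t ω = walkPosition A x₀ fun k : Fin n => J k ω

/-! Every row of the navigation matrix sums to δ, so after n renewals the coordinates sum to x₀ + y₀
+ δn whatever the colours were. The renewal rates are thus deterministic: the number of renewals is
a Yule process with immigration, independent of the urn chain K_n that counts the renewals of colour
0. The position is a function of n and K_n, so the theorem reduces to their joint law at time t.

That law has mass w(n, k) e^{-(x₀+y₀)t} (1 - e^{-δt})^n (`lintegral_renewal_count`), where w is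
`urnWeight` with p = α/δ, a = x₀/α, b = y₀/δ. The colour factor obeys the one-step recursion of the
urn (`urnWeight_succ_succ`); the time factor comes from convolving exponential laws
(`lintegral_yuleProfile_mul_exponentialPDF`).

The generating function of w has a closed form (`tsum_tsum_urnWeight`), and the moment generating
function is its value at r = (1 - e^{-δt}) e^{δv}, z = e^{α(u-v)}. At u = v = 0 the total mass is 1,
which excludes explosion. The moments are derivatives at 0 of the logarithm of the formula along
lines through the origin. -/

/-! ### Urn weights and their generating function -/

/-- The coefficient of `r ^ n` in the power series of `(1 - r) ^ (-s)`. -/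
noncomputable def risingCoeff (s : ℝ) (n : ℕ) : ℝ := ∏ i ∈ Finset.range n, (s + i) / (i + 1)

theorem risingCoeff_zero (s : ℝ) : risingCoeff s 0 = 1 := by simp [risingCoeff]

theorem risingCoeff_succ (s : ℝ) (n : ℕ) :
    ((n : ℝ) + 1) * risingCoeff s (n + 1) = (s + n) * risingCoeff s n := by
  have : (n : ℝ) + 1 ≠ 0 := by positivity
  rw [risingCoeff, Finset.prod_range_succ, ← risingCoeff]
  field_simp

theorem risingCoeff_nonneg {s : ℝ} (hs : 0 ≤ s) (n : ℕ) : 0 ≤ risingCoeff s n :=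
  Finset.prod_nonneg fun _ _ => by positivity

/-- Multiplied by n!, both sides become the rising factorial s(s+1)⋯(s+n-1). -/
theorem risingCoeff_eq_choose (s : ℝ) (n : ℕ) : risingCoeff s n = Ring.choose (s + n - 1) n := by
  have h1 : Ring.choose (s + n - 1) n = Ring.multichoose s n := by
    rw [Ring.choose]
    congr 1
    ring
  have h2 := Ring.factorial_nsmul_multichoose_eq_ascPochhammer s n
  rw [Polynomial.ascPochhammer_smeval_eq_eval] at h2
  rw [h1]
  have h3 : (n.factorial : ℝ) * risingCoeff s n = (ascPochhammer ℝ n).eval s := by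
    clear h1 h2
    induction n with
    | zero => simp [risingCoeff]
    | succ n ih =>
      rw [ascPochhammer_succ_eval, ← ih, Nat.factorial_succ]
      push_cast
      linear_combination (n.factorial : ℝ) * risingCoeff_succ s n
  rw [nsmul_eq_mul] at h2
  exact mul_left_cancel₀ (Nat.cast_ne_zero.2 n.factorial_ne_zero) (h3.trans h2.symm)

theorem hasSum_risingCoeff (s : ℝ) {r : ℝ} (hr : |r| < 1) :
    HasSum (fun n => risingCoeff s n * r ^ n) ((1 - r) ^ (-s)) := by
  have h := (Real.one_div_one_sub_rpow_hasFPowerSeriesOnBall_zero s).hasSum (y := r) (by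
    simpa [enorm_eq_nnnorm, ← NNReal.coe_lt_one] using hr)
  have h0 : 0 ≤ 1 - r := by linarith [le_abs_self r]
  simpa [Real.rpow_neg h0, ← risingCoeff_eq_choose, mul_comm] using h

/-- The coefficient of `r ^ n * z ^ k` in `(1 - r) ^ (-b) * (1 - z * (1 - (1 - r) ^ p)) ^ (-a)`. -/
noncomputable def urnWeight (p a b : ℝ) (n k : ℕ) : ℝ :=
  risingCoeff a k * ∑ j ∈ Finset.range (k + 1), (-1) ^ j * (k.choose j : ℝ) * risingCoeff (b - p * j) n

theorem urnWeight_zero_left (p a b : ℝ) (k : ℕ) : urnWeight p a b 0 k = if k = 0 then 1 else 0 := by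
  have h := Int.alternating_sum_range_choose (n := k)
  have h' : ∑ j ∈ Finset.range (k + 1), (-1 : ℝ) ^ j * (k.choose j : ℝ) = if k = 0 then 1 else 0 := by
    exact_mod_cast h
  simp only [urnWeight, risingCoeff_zero, mul_one, h']
  split_ifs with hk
  · simp [hk, risingCoeff_zero]
  · simp

theorem urnWeight_succ_zero (p a b : ℝ) (n : ℕ) :
    ((n : ℝ) + 1) * urnWeight p a b (n + 1) 0 = (b + n) * urnWeight p a b n 0 := by
  simpa [urnWeight, risingCoeff_zero] using risingCoeff_succ b n

/-- The forward equation of the urn: for p = α/δ, a = x₀/α, b = y₀/δ the two coefficients are 1/δ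
times the coordinates that produce colour 0 from count k and colour 1 from count k + 1. Termwise,
the first coefficient turns into p(k + 1 - j), and adding the second leaves b - pj + n, the factor
in `risingCoeff_succ`. -/
theorem urnWeight_succ_succ (p a b : ℝ) (n k : ℕ) :
    ((n : ℝ) + 1) * urnWeight p a b (n + 1) (k + 1)
      = p * (a + k) * urnWeight p a b n k
        + (b + n - p * ((k : ℝ) + 1)) * urnWeight p a b n (k + 1) := by
  have h1 : p * (a + k) * urnWeight p a b n k = risingCoeff a (k + 1) *
      ∑ j ∈ Finset.range (k + 2), p * ((k : ℝ) + 1 - j) *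
        ((-1) ^ j * ((k + 1).choose j : ℝ) * risingCoeff (b - p * j) n) := by
    rw [Finset.sum_range_succ]
    have : p * (a + k) * urnWeight p a b n k = p * ((k + 1) * risingCoeff a (k + 1)) *
        ∑ j ∈ Finset.range (k + 1), (-1) ^ j * (k.choose j : ℝ) * risingCoeff (b - p * j) n := by
      rw [risingCoeff_succ, urnWeight]
      ring
    rw [this]
    have h2 : ∀ j ∈ Finset.range (k + 1), p * ((k : ℝ) + 1 - j) *
        ((-1) ^ j * ((k + 1).choose j : ℝ) * risingCoeff (b - p * j) n) =
        p * (k + 1) * ((-1) ^ j * (k.choose j : ℝ) * risingCoeff (b - p * j) n) := by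
      intro j hj
      have hj' : j ≤ k + 1 := by
        have := Finset.mem_range.1 hj
        omega
      have h3 := Nat.choose_mul_succ_eq k j
      have h4 : (k.choose j : ℝ) * (k + 1) = (k + 1).choose j * ((k : ℝ) + 1 - j) := by
        rw [← Nat.cast_add_one, ← Nat.cast_sub hj']
        exact_mod_cast h3
      linear_combination (-(p * (-1) ^ j * risingCoeff (b - p * j) n)) * h4
    rw [Finset.sum_congr rfl h2, ← Finset.mul_sum]
    push_cast
    ring
  rw [h1]
  simp only [urnWeight]
  rw [mul_left_comm _ (risingCoeff a (k + 1)), mul_left_comm _ (risingCoeff a (k + 1)), ← mul_add]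
  congr 1
  rw [Finset.mul_sum, Finset.mul_sum, ← Finset.sum_add_distrib]
  refine Finset.sum_congr rfl fun j _ => ?_
  linear_combination ((-1) ^ j * ((k + 1).choose j : ℝ)) * risingCoeff_succ (b - p * j) n

theorem urnWeight_eq_zero_of_lt (p a b : ℝ) {n k : ℕ} (h : n < k) : urnWeight p a b n k = 0 := by
  induction n generalizing k with
  | zero => simp [urnWeight_zero_left, Nat.pos_iff_ne_zero.1 h]
  | succ n ih =>
    obtain ⟨k, rfl⟩ : ∃ m, k = m + 1 := ⟨k - 1, by omega⟩
    have := urnWeight_succ_succ p a b n k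
    rw [ih (show n < k by omega), ih (show n < k + 1 by omega), mul_zero, mul_zero, add_zero] at this
    exact (mul_eq_zero.1 this).resolve_left (by positivity)

/-- The alternating sum hides the sign, but the recursion shows it: its second coefficient is
nonnegative when k + 1 ≤ n, and otherwise the weight it multiplies vanishes. -/
theorem urnWeight_nonneg {p a b : ℝ} (hp : 0 ≤ p) (hp1 : p ≤ 1) (ha : 0 ≤ a) (hb : 0 ≤ b) (n k : ℕ) :
    0 ≤ urnWeight p a b n k := by
  induction n generalizing k with
  | zero => rw [urnWeight_zero_left]; split_ifs <;> norm_num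
  | succ n ih =>
    refine nonneg_of_mul_nonneg_right (a := (n : ℝ) + 1) ?_ (by positivity)
    cases k with
    | zero =>
      rw [urnWeight_succ_zero]
      exact mul_nonneg (by positivity) (ih 0)
    | succ k =>
      rw [urnWeight_succ_succ]
      refine add_nonneg (mul_nonneg (by positivity) (ih k)) ?_
      rcases lt_or_ge n (k + 1) with h | h
      · simp [urnWeight_eq_zero_of_lt p a b h]
      · refine mul_nonneg ?_ (ih _)
        have h' : (k : ℝ) + 1 ≤ n := by exact_mod_cast h
        have : p * ((k : ℝ) + 1) ≤ 1 * ((k : ℝ) + 1) := by gcongr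
        linarith

/-- Expanding (1 - (1 - r)^p)^k binomially gives powers of 1 - r with exponents -(b - pj), each of
which is a binomial series in r. -/
theorem hasSum_urnWeight (p a b : ℝ) (k : ℕ) {r : ℝ} (hr0 : 0 ≤ r) (hr : r < 1) :
    HasSum (fun n => urnWeight p a b n k * r ^ n)
      (risingCoeff a k * ((1 - r) ^ (-b) * (1 - (1 - r) ^ p) ^ k)) := by
  have hpos : 0 < 1 - r := by linarith
  have h : ∀ j ∈ Finset.range (k + 1), HasSum (fun n => (-1) ^ j * (k.choose j : ℝ) *
      risingCoeff (b - p * j) n * r ^ n)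
      ((-1) ^ j * (k.choose j : ℝ) * (1 - r) ^ (-(b - p * j))) := fun j _ => by
    simpa only [mul_assoc] using
      (hasSum_risingCoeff (b - p * j) (by rwa [abs_of_nonneg hr0])).mul_left
        ((-1) ^ j * (k.choose j : ℝ))
  have h' := (hasSum_sum h).mul_left (risingCoeff a k)
  have e1 : (fun n => urnWeight p a b n k * r ^ n) = fun n => risingCoeff a k *
      ∑ j ∈ Finset.range (k + 1), (-1) ^ j * (k.choose j : ℝ) * risingCoeff (b - p * j) n * r ^ n := by
    funext n
    rw [urnWeight, mul_assoc, Finset.sum_mul]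
  have e2 : (1 - r) ^ (-b) * (1 - (1 - r) ^ p) ^ k = ∑ j ∈ Finset.range (k + 1),
      (-1) ^ j * (k.choose j : ℝ) * (1 - r) ^ (-(b - p * j)) := by
    rw [sub_eq_neg_add 1 ((1 - r) ^ p), add_pow, Finset.mul_sum]
    refine Finset.sum_congr rfl fun j _ => ?_
    have e3 : (1 - r) ^ (-(b - p * j)) = (1 - r) ^ (-b) * ((1 - r) ^ p) ^ j := by
      rw [show -(b - p * j) = -b + p * j by ring, Real.rpow_add hpos, Real.rpow_mul hpos.le,
        Real.rpow_natCast]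
    rw [e3, neg_pow, one_pow]
    ring
  rw [e1, e2]
  exact h'

/-- Nonnegativity allows summing over n first; the sum over k is then a binomial series in z(1 - (1
- r)^p). -/
theorem tsum_tsum_urnWeight {p a b : ℝ} (hp : 0 ≤ p) (hp1 : p ≤ 1) (ha : 0 ≤ a) (hb : 0 ≤ b)
    {r z : ℝ} (hr0 : 0 ≤ r) (hr : r < 1) (hz : 0 ≤ z) (hzr : z * (1 - (1 - r) ^ p) < 1) :
    ∑' (n : ℕ) (k : ℕ), ENNReal.ofReal (urnWeight p a b n k * r ^ n * z ^ k)
      = ENNReal.ofReal ((1 - r) ^ (-b) * (1 - z * (1 - (1 - r) ^ p)) ^ (-a)) := by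
  have hq := urnWeight_nonneg hp hp1 ha hb
  have hβ : 0 ≤ 1 - (1 - r) ^ p :=
    sub_nonneg.2 (Real.rpow_le_one (by linarith) (by linarith) hp)
  have h1 : ∀ k, HasSum (fun n => urnWeight p a b n k * r ^ n * z ^ k)
      ((1 - r) ^ (-b) * (risingCoeff a k * (z * (1 - (1 - r) ^ p)) ^ k)) := by
    intro k
    have e : (1 - r) ^ (-b) * (risingCoeff a k * (z * (1 - (1 - r) ^ p)) ^ k)
        = risingCoeff a k * ((1 - r) ^ (-b) * (1 - (1 - r) ^ p) ^ k) * z ^ k := by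
      rw [mul_pow]
      ring
    rw [e]
    exact (hasSum_urnWeight p a b k hr0 hr).mul_right (z ^ k)
  have h2 : HasSum (fun k => (1 - r) ^ (-b) * (risingCoeff a k * (z * (1 - (1 - r) ^ p)) ^ k))
      ((1 - r) ^ (-b) * (1 - z * (1 - (1 - r) ^ p)) ^ (-a)) :=
    (hasSum_risingCoeff a (by rwa [abs_of_nonneg (mul_nonneg hz hβ)])).mul_left _
  have h3 : 0 ≤ (1 - r) ^ (-b) := Real.rpow_nonneg (by linarith) _
  rw [ENNReal.tsum_comm, ← h2.tsum_eq, ENNReal.ofReal_tsum_of_nonneg _ h2.summable]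
  · refine tsum_congr fun k => ?_
    rw [← (h1 k).tsum_eq, ENNReal.ofReal_tsum_of_nonneg _ (h1 k).summable]
    exact fun n => mul_nonneg (mul_nonneg (hq n k) (by positivity)) (by positivity)
  · exact fun k => mul_nonneg h3 (mul_nonneg (risingCoeff_nonneg ha k)
      (pow_nonneg (mul_nonneg hz hβ) k))

/-! ### Renewal times, colour counts and the one-step identity -/

/-- The waiting times `τ` and colours `J` of a walk with the balanced upper-triangular navigation
matrix. -/
def IsTriangularRenewalSequence {Ω : Type*} [MeasurableSpace Ω] (α δ x₀ y₀ : ℝ)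
    (τ : ℕ → Ω → ℝ) (J : ℕ → Ω → Fin 2) (P : Measure Ω) : Prop :=
  ∀ n, HasCondDistrib (fun ω => (τ n ω, J n ω)) (fun ω (k : Fin n) => (τ k ω, J k ω))
    ((renewalKernel 2).comap
      (fun h => walkPosition !![α, δ - α; 0, δ] ![x₀, y₀] fun k => (h k).2)
      (measurable_walkPosition !![α, δ - α; 0, δ] ![x₀, y₀] n)) P

/-- The time of the `n`-th renewal. -/
def renewalTime {Ω : Type*} (τ : ℕ → Ω → ℝ) (n : ℕ) (ω : Ω) : ℝ := ∑ k ∈ Finset.range n, τ k ω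

/-- The number of renewals of colour `0` among the first `n`. -/
def colourCount {Ω : Type*} (J : ℕ → Ω → Fin 2) (n : ℕ) (ω : Ω) : ℕ :=
  ∑ k ∈ Finset.range n, if J k ω = 0 then 1 else 0

/-- The position after `n` renewals, `k` of which have colour `0`. -/
def triangularPosition (α δ x₀ y₀ : ℝ) (n k : ℕ) : Fin 2 → ℝ :=
  ![x₀ + α * k, y₀ + δ * n - α * k]

theorem walkPosition_triangular (α δ x₀ y₀ : ℝ) {n : ℕ} (J : Fin n → Fin 2) :
    walkPosition !![α, δ - α; 0, δ] ![x₀, y₀] J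
      = triangularPosition α δ x₀ y₀ n (∑ k, if J k = 0 then 1 else 0) := by
  have h0 : ∀ j : Fin 2, (!![α, δ - α; 0, δ] : Matrix (Fin 2) (Fin 2) ℝ) j 0
      = α * (if j = 0 then 1 else 0) := by
    intro j; fin_cases j <;> simp
  have h1 : ∀ j : Fin 2, (!![α, δ - α; 0, δ] : Matrix (Fin 2) (Fin 2) ℝ) j 1
      = δ - α * (if j = 0 then 1 else 0) := by
    intro j; fin_cases j <;> simp
  ext i
  fin_cases i
  · simp [walkPosition, triangularPosition, Finset.sum_apply, h0, -Matrix.of_apply,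
      -Finset.sum_boole, -mul_ite, ← Finset.mul_sum]
  · simp [walkPosition, triangularPosition, Finset.sum_apply, h1, -Matrix.of_apply,
      -Finset.sum_boole, -mul_ite, ← Finset.mul_sum]
    ring

theorem walkPosition_eq_colourCount {Ω : Type*} (α δ x₀ y₀ : ℝ) (J : ℕ → Ω → Fin 2) (n : ℕ) (ω : Ω) :
    (walkPosition !![α, δ - α; 0, δ] ![x₀, y₀] fun k : Fin n => J k ω)
      = triangularPosition α δ x₀ y₀ n (colourCount J n ω) := by
  rw [walkPosition_triangular, colourCount, Finset.sum_range]

/-- Balance: the renewal rate does not depend on k, which decouples times from colours. -/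
theorem sum_triangularPosition (α δ x₀ y₀ : ℝ) (n k : ℕ) :
    ∑ i, triangularPosition α δ x₀ y₀ n k i = x₀ + y₀ + δ * n := by
  simp [triangularPosition]
  ring

theorem colourCount_le {Ω : Type*} (J : ℕ → Ω → Fin 2) (n : ℕ) (ω : Ω) : colourCount J n ω ≤ n := by
  refine (Finset.sum_le_card_nsmul _ _ 1 fun k _ => ?_).trans (by simp)
  split_ifs <;> simp

theorem lintegral_renewalKernel {c : ℕ} (z : Fin c → ℝ) {f : ℝ × Fin c → ENNReal} (hf : Measurable f) :
    ∫⁻ p, f p ∂(renewalKernel c z) = ∑ i, ENNReal.ofReal (z i / ∑ j, z j) *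
      ∫⁻ x, exponentialPDF (∑ j, z j) x * f (x, i) := by
  have hpdf : Measurable (exponentialPDF (∑ j, z j)) :=
    (measurable_exponentialPDFReal _).ennreal_ofReal
  rw [renewalKernel, Kernel.prod_apply, lintegral_prod _ hf.aemeasurable]
  have h1 : ∀ x, ∫⁻ y, f (x, y) ∂(colourKernel c z)
      = ∑ i, ENNReal.ofReal (z i / ∑ j, z j) * f (x, i) := by
    intro x
    change ∫⁻ y, f (x, y) ∂(∑ i, ENNReal.ofReal (z i / ∑ j, z j) • Measure.dirac i : Measure (Fin c)) = _
    simp [lintegral_finsetSum_measure]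
  simp_rw [h1]
  rw [lintegral_finsetSum _ fun i _ => by fun_prop]
  refine Finset.sum_congr rfl fun i _ => ?_
  rw [lintegral_const_mul' _ _ ENNReal.ofReal_ne_top]
  congr 1
  change ∫⁻ x, f (x, i) ∂(volume.withDensity (exponentialPDF (∑ j, z j))) = _
  rw [lintegral_withDensity_eq_lintegral_mul _ hpdf (by fun_prop)]
  rfl

namespace IsTriangularRenewalSequence

variable {Ω : Type*} [MeasurableSpace Ω] {α δ x₀ y₀ : ℝ} {τ : ℕ → Ω → ℝ} {J : ℕ → Ω → Fin 2}
  {P : Measure Ω}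

theorem aemeasurable_waiting (h : IsTriangularRenewalSequence α δ x₀ y₀ τ J P) (n : ℕ) :
    AEMeasurable (τ n) P := (h n).aemeasurable_snd.fst

theorem aemeasurable_colour (h : IsTriangularRenewalSequence α δ x₀ y₀ τ J P) (n : ℕ) :
    AEMeasurable (J n) P := (h n).aemeasurable_snd.snd

theorem aemeasurable_renewalTime (h : IsTriangularRenewalSequence α δ x₀ y₀ τ J P) (n : ℕ) :
    AEMeasurable (renewalTime τ n) P :=
  Finset.aemeasurable_fun_sum _ fun k _ => h.aemeasurable_waiting k

theorem aemeasurable_colourCount (h : IsTriangularRenewalSequence α δ x₀ y₀ τ J P) (n : ℕ) :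
    AEMeasurable (colourCount J n) P :=
  Finset.aemeasurable_fun_sum _ fun k _ =>
    (Measurable.of_discrete (f := fun j : Fin 2 => if j = 0 then 1 else 0)).comp_aemeasurable
      (h.aemeasurable_colour k)

theorem lintegral_history_succ [IsProbabilityMeasure P]
    (h : IsTriangularRenewalSequence α δ x₀ y₀ τ J P) (n : ℕ)
    {F : (Fin n → ℝ × Fin 2) × (ℝ × Fin 2) → ENNReal} (hF : Measurable F) :
    ∫⁻ ω, F (fun k => (τ k ω, J k ω), (τ n ω, J n ω)) ∂P
      = ∫⁻ ω, ∑ i, ENNReal.ofReal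
          (triangularPosition α δ x₀ y₀ n (colourCount J n ω) i / (x₀ + y₀ + δ * n)) *
          (∫⁻ x, exponentialPDF (x₀ + y₀ + δ * n) x * F (fun k => (τ k ω, J k ω), (x, i))) ∂P := by
  have hn := h n
  have hm := hn.aemeasurable_fst
  rw [← lintegral_map' (f := F) hF.aemeasurable hn.aemeasurable, HasLaw.map_eq hn]
  have : IsProbabilityMeasure (P.map fun ω (k : Fin n) => (τ k ω, J k ω)) :=
    Measure.isProbabilityMeasure_map hm
  have : IsSFiniteKernel (renewalKernel 2) := by
    unfold renewalKernel
    infer_instance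
  rw [Measure.lintegral_compProd hF, lintegral_map' _ hm]
  · refine lintegral_congr fun ω => ?_
    rw [Kernel.comap_apply, lintegral_renewalKernel _ (by fun_prop)]
    have := walkPosition_eq_colourCount α δ x₀ y₀ J n ω
    simp only [this, sum_triangularPosition]
  · exact (hF.lintegral_kernel_prod_right').aemeasurable

/-- The Markov property for functionals that see the past only through the colour count and the
renewal time. On a fixed count the colour probability is constant and leaves the integral. -/
theorem lintegral_step [IsProbabilityMeasure P]
    (h : IsTriangularRenewalSequence α δ x₀ y₀ τ J P) (n k : ℕ) (i : Fin 2)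
    {G : ℝ × ℝ → ENNReal} (hG : Measurable G) :
    ∫⁻ ω, (if colourCount J n ω = k ∧ J n ω = i then G (renewalTime τ n ω, τ n ω) else 0) ∂P
      = ENNReal.ofReal (triangularPosition α δ x₀ y₀ n k i / (x₀ + y₀ + δ * n)) *
        ∫⁻ ω, (if colourCount J n ω = k then
          ∫⁻ x, exponentialPDF (x₀ + y₀ + δ * n) x * G (renewalTime τ n ω, x) else 0) ∂P := by
  have hK : Measurable fun g : Fin n → ℝ × Fin 2 => ∑ k : Fin n, if (g k).2 = 0 then 1 else 0 :=
    Finset.measurable_fun_sum _ fun k _ =>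
      (Measurable.of_discrete (f := fun j : Fin 2 => if j = 0 then 1 else 0)).comp
        (measurable_snd.comp (measurable_pi_apply k))
  have hS : Measurable fun g : Fin n → ℝ × Fin 2 => ∑ k : Fin n, (g k).1 :=
    Finset.measurable_fun_sum _ fun k _ => measurable_fst.comp (measurable_pi_apply k)
  have key := h.lintegral_history_succ n (F := fun g =>
    if (∑ k : Fin n, if (g.1 k).2 = 0 then 1 else 0) = k ∧ g.2.2 = i then
      G (∑ k : Fin n, (g.1 k).1, g.2.1) else 0) (by
    refine Measurable.ite (MeasurableSet.inter ?_ ?_) (by fun_prop) measurable_const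
    · exact (hK.comp measurable_fst) (measurableSet_singleton k)
    · exact (measurable_snd.comp measurable_snd) (measurableSet_singleton i))
  have eK : ∀ ω, (∑ k : Fin n, if J k ω = 0 then 1 else 0) = colourCount J n ω := fun ω =>
    (Finset.sum_range fun k => if J k ω = 0 then 1 else 0).symm
  have eS : ∀ ω, (∑ k : Fin n, τ k ω) = renewalTime τ n ω := fun ω =>
    (Finset.sum_range fun k => τ k ω).symm
  simp only [eK, eS] at key
  rw [← lintegral_const_mul' _ _ ENNReal.ofReal_ne_top]
  refine key.trans (lintegral_congr fun ω => ?_)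
  rw [Finset.sum_eq_single i]
  · by_cases hk : colourCount J n ω = k <;> simp [hk]
  · intro j _ hj
    simp [hj]
  · simp

theorem ae_waiting_nonneg [IsProbabilityMeasure P]
    (h : IsTriangularRenewalSequence α δ x₀ y₀ τ J P) : ∀ᵐ ω ∂P, ∀ n, 0 ≤ τ n ω := by
  refine ae_all_iff.2 fun n => ?_
  have hs : MeasurableSet {x : ℝ | x < 0} := measurableSet_lt measurable_id measurable_const
  have key := h.lintegral_history_succ n (F := fun g => {x : ℝ | x < 0}.indicator 1 g.2.1)
    ((measurable_one.indicator hs).comp (measurable_fst.comp measurable_snd))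
  have h0 : ∀ r x : ℝ, exponentialPDF r x * {x : ℝ | x < 0}.indicator 1 x = 0 := by
    intro r x
    by_cases hx : x < 0
    · simp [exponentialPDF_of_neg hx]
    · simp [hx]
  simp only [h0, lintegral_zero, mul_zero, Finset.sum_const_zero] at key
  have key' : ∫⁻ ω, ({x : ℝ | x < 0}.indicator 1 ∘ τ n) ω ∂P = 0 := key
  rw [lintegral_eq_zero_iff'
    ((measurable_one.indicator hs).comp_aemeasurable (h.aemeasurable_waiting n))] at key'
  filter_upwards [key'] with ω hω
  by_contra hlt
  simp [not_le.1 hlt] at hω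

end IsTriangularRenewalSequence

/-! ### Convolving the Yule profile with an exponential law -/

/-- Up to a normalizing constant, the probability that a Yule process with immigration, whose
`n`-th rate is `s + δ * n`, has made exactly `n` jumps at time `x`. -/
noncomputable def yuleProfile (s δ : ℝ) (n : ℕ) (x : ℝ) : ENNReal :=
  ENNReal.ofReal (if 0 ≤ x then Real.exp (-(s * x)) * (1 - Real.exp (-(δ * x))) ^ n else 0)

theorem measurable_yuleProfile (s δ : ℝ) (n : ℕ) : Measurable (yuleProfile s δ n) := by
  refine ENNReal.measurable_ofReal.comp (Measurable.ite ?_ (by fun_prop) measurable_const)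
  exact measurableSet_le measurable_const measurable_id

theorem measurable_exponentialPDF (s : ℝ) : Measurable (exponentialPDF s) :=
  (measurable_exponentialPDFReal s).ennreal_ofReal

theorem exponentialPDF_eq_yuleProfile {s : ℝ} (hs : 0 ≤ s) (δ x : ℝ) :
    exponentialPDF s x = ENNReal.ofReal s * yuleProfile s δ 0 x := by
  rw [exponentialPDF_eq, yuleProfile, ← ENNReal.ofReal_mul hs]
  split_ifs <;> simp

/-- On 0 < x ≤ z the integrand is a constant times e^{δx}(e^{δx} - 1)^n, with primitive (e^{δx} -
1)^{n+1} / ((n+1)δ). -/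
theorem lintegral_yuleProfile_mul_exponentialPDF {s δ : ℝ} (hs : 0 < s) (hδ : 0 < δ) (n : ℕ) (z : ℝ) :
    ∫⁻ x, yuleProfile s δ n x * exponentialPDF (s + δ * ↑(n + 1)) (z - x)
      = ENNReal.ofReal ((s + δ * ↑(n + 1)) / ((n + 1) * δ)) * yuleProfile s δ (n + 1) z := by
  have hs' : 0 < s + δ * ↑(n + 1) := by positivity
  rcases lt_or_ge z 0 with hz | hz
  · have h0 : ∀ x, yuleProfile s δ n x * exponentialPDF (s + δ * ↑(n + 1)) (z - x) = 0 := by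
      intro x
      rcases lt_or_ge x 0 with hx | hx
      · simp [yuleProfile, not_le.2 hx]
      · rw [exponentialPDF_of_neg (by linarith), mul_zero]
    rw [lintegral_congr h0, lintegral_zero]
    simp [yuleProfile, not_le.2 hz]
  set f : ℝ → ℝ := fun x => (s + δ * ↑(n + 1)) * Real.exp (-((s + δ * ↑(n + 1)) * z)) *
    (Real.exp (δ * x) * (Real.exp (δ * x) - 1) ^ n) with hf
  -- The point 0 is set aside: for n = 0 the profile equals 1 there, while the half-open interval,
  -- chosen to match the interval integral, omits it.
  have hpt : ∀ x, yuleProfile s δ n x * exponentialPDF (s + δ * ↑(n + 1)) (z - x)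
      = (Set.Ioc 0 z).indicator (fun x => ENNReal.ofReal (f x)) x
        ∨ x = 0 := by
    intro x
    by_cases hx : x = 0
    · exact Or.inr hx
    left
    by_cases hxz : x ∈ Set.Ioc 0 z
    · have hb : 0 ≤ 1 - Real.exp (-(δ * x)) := by
        have : 0 < δ * x := mul_pos hδ hxz.1
        simpa using this.le
      rw [Set.indicator_of_mem hxz, yuleProfile, if_pos hxz.1.le,
        exponentialPDF_of_nonneg (by linarith [hxz.2]), ← ENNReal.ofReal_mul (by positivity), hf]
      congr 1
      have e1 : Real.exp (-((s + δ * ↑(n + 1)) * (z - x)))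
          = Real.exp (-((s + δ * ↑(n + 1)) * z)) * (Real.exp (s * x) * Real.exp (δ * x) ^ (n + 1)) := by
        rw [← Real.exp_nat_mul, ← Real.exp_add, ← Real.exp_add]
        congr 1
        ring
      have e2 : Real.exp (-(s * x)) * Real.exp (s * x) = 1 := by rw [← Real.exp_add]; simp
      have e3 : (1 - Real.exp (-(δ * x))) ^ n * Real.exp (δ * x) ^ n = (Real.exp (δ * x) - 1) ^ n := by
        rw [← mul_pow, sub_mul, ← Real.exp_add]
        simp
      beta_reduce
      rw [e1, ← e3, pow_succ]
      linear_combination ((s + δ * ↑(n + 1)) * Real.exp (-((s + δ * ↑(n + 1)) * z)) *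
        Real.exp (δ * x) ^ n * Real.exp (δ * x) * (1 - Real.exp (-(δ * x))) ^ n) * e2
    · rw [Set.indicator_of_notMem hxz]
      rcases lt_or_ge x 0 with hx0 | hx0
      · simp [yuleProfile, not_le.2 hx0]
      · have : z < x := by
          by_contra hc
          exact hxz ⟨lt_of_le_of_ne hx0 (Ne.symm hx), not_lt.1 hc⟩
        rw [exponentialPDF_of_neg (by linarith), mul_zero]
  have hae : (fun x => yuleProfile s δ n x * exponentialPDF (s + δ * ↑(n + 1)) (z - x))
      =ᵐ[volume] (Set.Ioc 0 z).indicator fun x => ENNReal.ofReal (f x) := by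
    have : ∀ᵐ x : ℝ, x ≠ 0 := by simp [ae_iff]
    filter_upwards [this] with x hx
    exact (hpt x).resolve_right hx
  have hint : ∫ x in (0 : ℝ)..z, f x = (s + δ * ↑(n + 1)) * Real.exp (-((s + δ * ↑(n + 1)) * z)) *
      ((Real.exp (δ * z) - 1) ^ (n + 1) / ((n + 1) * δ)) := by
    rw [hf, intervalIntegral.integral_const_mul]
    congr 1
    rw [intervalIntegral.integral_eq_sub_of_hasDerivAt
      (f := fun x => (Real.exp (δ * x) - 1) ^ (n + 1) / ((n + 1) * δ))]
    · simp
    · intro x _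
      have h1 : HasDerivAt (fun x => Real.exp (δ * x) - 1) (Real.exp (δ * x) * (δ * 1)) x :=
        (((hasDerivAt_id x).const_mul δ).exp).sub_const 1
      refine ((h1.fun_pow (n + 1)).div_const ((n + 1) * δ)).congr_deriv ?_
      have : (n : ℝ) + 1 ≠ 0 := by positivity
      rw [Nat.add_sub_cancel]
      push_cast
      field_simp
    · exact Continuous.intervalIntegrable (by fun_prop) _ _
  have hfnn : ∀ x ∈ Set.Ioc 0 z, 0 ≤ f x := by
    intro x hx
    have : 0 ≤ Real.exp (δ * x) - 1 := by
      have : 0 < δ * x := mul_pos hδ hx.1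
      simpa using this.le
    positivity
  rw [lintegral_congr_ae hae, lintegral_indicator measurableSet_Ioc,
    ← ofReal_integral_eq_lintegral_ofReal, ← intervalIntegral.integral_of_le hz, hint, yuleProfile,
    if_pos hz, ← ENNReal.ofReal_mul (by positivity)]
  · congr 1
    have e1 : Real.exp (-((s + δ * ↑(n + 1)) * z))
        = Real.exp (-(s * z)) * Real.exp (-(δ * z)) ^ (n + 1) := by
      rw [← Real.exp_nat_mul, ← Real.exp_add]
      congr 1
      ring
    have e2 : Real.exp (-(δ * z)) ^ (n + 1) * (Real.exp (δ * z) - 1) ^ (n + 1)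
        = (1 - Real.exp (-(δ * z))) ^ (n + 1) := by
      rw [← mul_pow, mul_sub, ← Real.exp_add]
      simp
    rw [e1, ← e2]
    ring
  · exact (Continuous.continuousOn (by fun_prop)).integrableOn_Icc.mono_set Set.Ioc_subset_Icc_self
  · exact (ae_restrict_mem measurableSet_Ioc).mono hfnn

theorem colourCount_succ {Ω : Type*} (J : ℕ → Ω → Fin 2) (n : ℕ) (ω : Ω) :
    colourCount J (n + 1) ω = colourCount J n ω + if J n ω = 0 then 1 else 0 :=
  Finset.sum_range_succ _ n

theorem renewalTime_succ {Ω : Type*} (τ : ℕ → Ω → ℝ) (n : ℕ) (ω : Ω) :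
    renewalTime τ (n + 1) ω = renewalTime τ n ω + τ n ω :=
  Finset.sum_range_succ _ n

/-! ### Joint law of the renewal count and the colour count -/

namespace IsTriangularRenewalSequence

variable {Ω : Type*} [MeasurableSpace Ω] {α δ x₀ y₀ : ℝ} {τ : ℕ → Ω → ℝ} {J : ℕ → Ω → Fin 2}
  {P : Measure Ω}

theorem lintegral_step_zero [IsProbabilityMeasure P]
    (h : IsTriangularRenewalSequence α δ x₀ y₀ τ J P) (n : ℕ) {g : ℝ → ENNReal} (hg : Measurable g) :
    ∫⁻ ω, (if colourCount J (n + 1) ω = 0 then g (renewalTime τ (n + 1) ω) else 0) ∂P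
      = ENNReal.ofReal (triangularPosition α δ x₀ y₀ n 0 1 / (x₀ + y₀ + δ * n)) *
        ∫⁻ ω, (if colourCount J n ω = 0 then
          ∫⁻ x, exponentialPDF (x₀ + y₀ + δ * n) x * g (renewalTime τ n ω + x) else 0) ∂P := by
  rw [← h.lintegral_step n 0 1 (G := fun p => g (p.1 + p.2)) (by fun_prop)]
  refine lintegral_congr fun ω => ?_
  have hJ : J n ω = 0 ∨ J n ω = 1 := by generalize J n ω = j; fin_cases j <;> simp
  rcases hJ with hJ | hJ <;> simp [colourCount_succ, renewalTime_succ, hJ]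

theorem lintegral_step_succ [IsProbabilityMeasure P]
    (h : IsTriangularRenewalSequence α δ x₀ y₀ τ J P) (n k : ℕ) {g : ℝ → ENNReal}
    (hg : Measurable g) :
    ∫⁻ ω, (if colourCount J (n + 1) ω = k + 1 then g (renewalTime τ (n + 1) ω) else 0) ∂P
      = ENNReal.ofReal (triangularPosition α δ x₀ y₀ n k 0 / (x₀ + y₀ + δ * n)) *
        ∫⁻ ω, (if colourCount J n ω = k then
          ∫⁻ x, exponentialPDF (x₀ + y₀ + δ * n) x * g (renewalTime τ n ω + x) else 0) ∂P
      + ENNReal.ofReal (triangularPosition α δ x₀ y₀ n (k + 1) 1 / (x₀ + y₀ + δ * n)) *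
        ∫⁻ ω, (if colourCount J n ω = k + 1 then
          ∫⁻ x, exponentialPDF (x₀ + y₀ + δ * n) x * g (renewalTime τ n ω + x) else 0) ∂P := by
  rw [← h.lintegral_step n k 0 (G := fun p => g (p.1 + p.2)) (by fun_prop),
    ← h.lintegral_step n (k + 1) 1 (G := fun p => g (p.1 + p.2)) (by fun_prop),
    ← lintegral_add_left']
  · refine lintegral_congr fun ω => ?_
    have hJ : J n ω = 0 ∨ J n ω = 1 := by generalize J n ω = j; fin_cases j <;> simp
    rcases hJ with hJ | hJ <;> simp [colourCount_succ, renewalTime_succ, hJ]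
  · have hm : Measurable fun p : ℕ × Fin 2 × ℝ × ℝ =>
        if p.1 = k ∧ p.2.1 = 0 then g (p.2.2.1 + p.2.2.2) else 0 :=
      Measurable.ite (MeasurableSet.inter (measurable_fst (measurableSet_singleton k))
        ((measurable_fst.comp measurable_snd) (measurableSet_singleton (0 : Fin 2))))
        (by fun_prop) measurable_const
    exact hm.comp_aemeasurable ((h.aemeasurable_colourCount n).prodMk ((h.aemeasurable_colour n).prodMk
      ((h.aemeasurable_renewalTime n).prodMk (h.aemeasurable_waiting n))))

/-- If `T_n`, `K_n` are the time and the number of colours `0` of the first `n` renewals, then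
convolving the law of `T_n` on `{K_n = k}` with the exponential law of rate `x₀ + y₀ + δ * n` gives
a multiple of the Yule profile; the left-hand side describes the law of `T_{n + 1}`. -/
theorem lintegral_step_of_profile [IsProbabilityMeasure P]
    (h : IsTriangularRenewalSequence α δ x₀ y₀ τ J P) (hα : 0 < α) (hαδ : α < δ)
    (hx₀ : 0 ≤ x₀) (hy₀ : 0 ≤ y₀) (hxy₀ : 0 < x₀ + y₀) (n : ℕ) {g : ℝ → ENNReal}
    (hg : Measurable g)
    (ih : ∀ k, ∫⁻ ω, (if colourCount J n ω = k then
          ∫⁻ x, exponentialPDF (x₀ + y₀ + δ * n) x * g (renewalTime τ n ω + x) else 0) ∂P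
      = ENNReal.ofReal ((x₀ + y₀ + δ * n) * urnWeight (α / δ) (x₀ / α) (y₀ / δ) n k) *
        ∫⁻ x, yuleProfile (x₀ + y₀) δ n x * g x) (k : ℕ) :
    ∫⁻ ω, (if colourCount J (n + 1) ω = k then g (renewalTime τ (n + 1) ω) else 0) ∂P
      = ENNReal.ofReal ((n + 1) * δ * urnWeight (α / δ) (x₀ / α) (y₀ / δ) (n + 1) k) *
        ∫⁻ x, yuleProfile (x₀ + y₀) δ n x * g x := by
  have hδ : 0 < δ := hα.trans hαδ
  have hs : 0 < x₀ + y₀ + δ * n := by positivity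
  have hq := urnWeight_nonneg (p := α / δ) (a := x₀ / α) (b := y₀ / δ) (by positivity)
    ((div_le_one hδ).2 hαδ.le) (by positivity) (by positivity)
  cases k with
  | zero =>
    rw [h.lintegral_step_zero n hg, ih, ← mul_assoc, ← ENNReal.ofReal_mul]
    · congr 2
      have e := urnWeight_succ_zero (α / δ) (x₀ / α) (y₀ / δ) n
      rw [mul_right_comm, e]
      simp only [triangularPosition, Matrix.cons_val_one, Matrix.cons_val_fin_one]
      field_simp
      push_cast
      ring
    · simp only [triangularPosition, Matrix.cons_val_one, Matrix.cons_val_fin_one]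
      have : 0 ≤ y₀ + δ * n - α * (0 : ℕ) := by simp; positivity
      positivity
  | succ k =>
    have hz0 : 0 ≤ triangularPosition α δ x₀ y₀ n k 0 := by
      simp only [triangularPosition, Matrix.cons_val_zero]
      positivity
    -- For k + 1 > n the second coordinate can be negative and `ENNReal.ofReal` would truncate it;
    -- the urn weight is then 0.
    have hcase : ENNReal.ofReal (triangularPosition α δ x₀ y₀ n (k + 1) 1 / (x₀ + y₀ + δ * n)) *
        ENNReal.ofReal ((x₀ + y₀ + δ * n) * urnWeight (α / δ) (x₀ / α) (y₀ / δ) n (k + 1))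
        = ENNReal.ofReal (triangularPosition α δ x₀ y₀ n (k + 1) 1 *
          urnWeight (α / δ) (x₀ / α) (y₀ / δ) n (k + 1)) ∧
        0 ≤ triangularPosition α δ x₀ y₀ n (k + 1) 1 *
          urnWeight (α / δ) (x₀ / α) (y₀ / δ) n (k + 1) := by
      rcases lt_or_ge n (k + 1) with hnk | hnk
      · simp [urnWeight_eq_zero_of_lt _ _ _ hnk]
      · have hz1 : 0 ≤ triangularPosition α δ x₀ y₀ n (k + 1) 1 := by
          simp only [triangularPosition, Matrix.cons_val_one, Matrix.cons_val_fin_one]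
          have h1 : ((k + 1 : ℕ) : ℝ) ≤ n := by exact_mod_cast hnk
          have : α * ((k + 1 : ℕ) : ℝ) ≤ δ * n := by gcongr
          linarith
        refine ⟨?_, mul_nonneg hz1 (hq _ _)⟩
        rw [← ENNReal.ofReal_mul (by positivity)]
        congr 1
        field_simp
    rw [h.lintegral_step_succ n k hg, ih, ih, ← mul_assoc, ← mul_assoc, hcase.1, ← add_mul,
      ← ENNReal.ofReal_mul (by positivity), ← ENNReal.ofReal_add _ hcase.2]
    · congr 2
      have e := urnWeight_succ_succ (α / δ) (x₀ / α) (y₀ / δ) n k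
      rw [mul_right_comm, e]
      simp only [triangularPosition, Matrix.cons_val_zero, Matrix.cons_val_one,
        Matrix.cons_val_fin_one]
      push_cast
      field_simp
    · have := hq n k
      positivity

/-- The induction follows T_n plus an independent exponential time instead of T_n, because T_0 = 0
has no density. Testing against arbitrary g lets the step absorb the next exponential kernel into g.
-/
theorem lintegral_exponentialPDF_renewalTime [IsProbabilityMeasure P]
    (h : IsTriangularRenewalSequence α δ x₀ y₀ τ J P) (hα : 0 < α) (hαδ : α < δ)
    (hx₀ : 0 ≤ x₀) (hy₀ : 0 ≤ y₀) (hxy₀ : 0 < x₀ + y₀) (n : ℕ) {g : ℝ → ENNReal}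
    (hg : Measurable g) (k : ℕ) :
    ∫⁻ ω, (if colourCount J n ω = k then
          ∫⁻ x, exponentialPDF (x₀ + y₀ + δ * n) x * g (renewalTime τ n ω + x) else 0) ∂P
      = ENNReal.ofReal ((x₀ + y₀ + δ * n) * urnWeight (α / δ) (x₀ / α) (y₀ / δ) n k) *
        ∫⁻ x, yuleProfile (x₀ + y₀) δ n x * g x := by
  have hδ : 0 < δ := hα.trans hαδ
  induction n generalizing g k with
  | zero =>
    rw [urnWeight_zero_left]
    rcases eq_or_ne k 0 with rfl | hk
    · simp only [colourCount, renewalTime, Finset.range_zero, Finset.sum_empty, if_true,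
        lintegral_const, measure_univ, mul_one, zero_add, Nat.cast_zero, mul_zero, add_zero]
      rw [← lintegral_const_mul' _ _ ENNReal.ofReal_ne_top]
      refine lintegral_congr fun x => ?_
      rw [exponentialPDF_eq_yuleProfile hxy₀.le δ, mul_assoc]
    · simp [colourCount, hk, hk.symm]
  | succ n ih =>
    have hG : Measurable fun s => ∫⁻ x, exponentialPDF (x₀ + y₀ + δ * ↑(n + 1)) x * g (s + x) := by
      refine Measurable.lintegral_prod_right'
        (f := fun p : ℝ × ℝ => exponentialPDF (x₀ + y₀ + δ * ↑(n + 1)) p.2 * g (p.1 + p.2)) ?_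
      exact ((measurable_exponentialPDF _).comp measurable_snd).mul (by fun_prop)
    rw [h.lintegral_step_of_profile hα hαδ hx₀ hy₀ hxy₀ n hG (ih hG)]
    -- Substitute z = x + y and exchange the integrals; the inner one is the Yule convolution.
    have hconv : ∫⁻ x, yuleProfile (x₀ + y₀) δ n x *
        ∫⁻ y, exponentialPDF (x₀ + y₀ + δ * ↑(n + 1)) y * g (x + y)
        = ENNReal.ofReal ((x₀ + y₀ + δ * ↑(n + 1)) / ((n + 1) * δ)) *
          ∫⁻ z, yuleProfile (x₀ + y₀) δ (n + 1) z * g z := by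
      calc _ = ∫⁻ x, ∫⁻ z, yuleProfile (x₀ + y₀) δ n x *
            (exponentialPDF (x₀ + y₀ + δ * ↑(n + 1)) (z - x) * g z) := by
            refine lintegral_congr fun x => ?_
            rw [lintegral_const_mul' (yuleProfile (x₀ + y₀) δ n x) _ ENNReal.ofReal_ne_top,
              ← lintegral_sub_right_eq_self (μ := volume)
                (fun y => exponentialPDF (x₀ + y₀ + δ * ↑(n + 1)) y * g (x + y)) x]
            simp
        _ = ∫⁻ z, ∫⁻ x, yuleProfile (x₀ + y₀) δ n x *
            (exponentialPDF (x₀ + y₀ + δ * ↑(n + 1)) (z - x) * g z) := by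
            refine lintegral_lintegral_swap (Measurable.aemeasurable ?_)
            exact ((measurable_yuleProfile _ _ _).comp measurable_fst).mul
              (((measurable_exponentialPDF _).comp (measurable_snd.sub measurable_fst)).mul
                (hg.comp measurable_snd))
        _ = _ := by
            rw [← lintegral_const_mul' _ _ ENNReal.ofReal_ne_top]
            refine lintegral_congr fun z => ?_
            simp_rw [← mul_assoc]
            have hm : Measurable fun x => yuleProfile (x₀ + y₀) δ n x *
                exponentialPDF (x₀ + y₀ + δ * ↑(n + 1)) (z - x) :=
              (measurable_yuleProfile _ _ _).mul
                ((measurable_exponentialPDF _).comp (measurable_const.sub measurable_id))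
            rw [lintegral_mul_const _ hm,
              lintegral_yuleProfile_mul_exponentialPDF hxy₀ hδ]
    have hq := urnWeight_nonneg (p := α / δ) (a := x₀ / α) (b := y₀ / δ) (by positivity)
      ((div_le_one hδ).2 hαδ.le) (by positivity) (by positivity) (n + 1) k
    rw [hconv, ← mul_assoc, ← ENNReal.ofReal_mul (by positivity)]
    congr 2
    field_simp

/-- The joint law of the number of renewals up to time `t` and the number of those of colour `0`. -/
theorem lintegral_renewal_count [IsProbabilityMeasure P]
    (h : IsTriangularRenewalSequence α δ x₀ y₀ τ J P) (hα : 0 < α) (hαδ : α < δ)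
    (hx₀ : 0 ≤ x₀) (hy₀ : 0 ≤ y₀) (hxy₀ : 0 < x₀ + y₀) (n k : ℕ) {t : ℝ} (ht : 0 ≤ t) :
    ∫⁻ ω, (if colourCount J n ω = k ∧ renewalTime τ n ω ≤ t ∧ t < renewalTime τ (n + 1) ω
        then 1 else 0) ∂P
      = ENNReal.ofReal (urnWeight (α / δ) (x₀ / α) (y₀ / δ) n k *
          (Real.exp (-((x₀ + y₀) * t)) * (1 - Real.exp (-(δ * t))) ^ n)) := by
  have hδ : 0 < δ := hα.trans hαδ
  have hs : 0 < x₀ + y₀ + δ * n := by positivity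
  have hG : MeasurableSet {p : ℝ × ℝ | p.1 ≤ t ∧ t < p.1 + p.2} :=
    (measurableSet_le measurable_fst measurable_const).inter
      (measurableSet_lt measurable_const (measurable_fst.add measurable_snd))
  have hstep := fun i => h.lintegral_step n k i
    (G := {p : ℝ × ℝ | p.1 ≤ t ∧ t < p.1 + p.2}.indicator 1) (measurable_one.indicator hG)
  rcases lt_or_ge n k with hnk | hkn
  · have h0 : ∀ ω, colourCount J n ω ≠ k := fun ω => ((colourCount_le J n ω).trans_lt hnk).ne
    simp [h0, urnWeight_eq_zero_of_lt _ _ _ hnk]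
  have hsum : ∑ i, ENNReal.ofReal (triangularPosition α δ x₀ y₀ n k i / (x₀ + y₀ + δ * n)) = 1 := by
    rw [← ENNReal.ofReal_sum_of_nonneg, ← Finset.sum_div, sum_triangularPosition, div_self hs.ne',
      ENNReal.ofReal_one]
    intro i _
    refine div_nonneg ?_ hs.le
    fin_cases i
    · simp only [triangularPosition]
      simp
      positivity
    · simp only [triangularPosition]
      have h1 : (k : ℝ) ≤ n := by exact_mod_cast hkn
      have : α * (k : ℝ) ≤ δ * n := by gcongr
      simp
      linarith
  have hsplit : ∫⁻ ω, (if colourCount J n ω = k ∧ renewalTime τ n ω ≤ t ∧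
        t < renewalTime τ (n + 1) ω then 1 else 0) ∂P
      = ∑ i, ∫⁻ ω, (if colourCount J n ω = k ∧ J n ω = i then
        {p : ℝ × ℝ | p.1 ≤ t ∧ t < p.1 + p.2}.indicator 1 (renewalTime τ n ω, τ n ω) else 0) ∂P := by
    have hm : ∀ i : Fin 2, Measurable fun p : ℕ × Fin 2 × ℝ × ℝ => if p.1 = k ∧ p.2.1 = i then
        {p : ℝ × ℝ | p.1 ≤ t ∧ t < p.1 + p.2}.indicator (1 : ℝ × ℝ → ENNReal) p.2.2 else 0 :=
      fun i => Measurable.ite (MeasurableSet.inter (measurable_fst (measurableSet_singleton k))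
        ((measurable_fst.comp measurable_snd) (measurableSet_singleton i)))
        ((measurable_one.indicator hG).comp (measurable_snd.comp measurable_snd)) measurable_const
    refine Eq.trans ?_ (lintegral_finsetSum' _ fun i _ => (hm i).comp_aemeasurable
      ((h.aemeasurable_colourCount n).prodMk ((h.aemeasurable_colour n).prodMk
        ((h.aemeasurable_renewalTime n).prodMk (h.aemeasurable_waiting n)))))
    refine lintegral_congr fun ω => ?_
    by_cases hk : colourCount J n ω = k <;>
      simp [hk, renewalTime_succ, Set.indicator_apply]
  -- An exponential tail is its density divided by the rate, so the event that no further renewal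
  -- occurs by time t becomes a density evaluated at t - s.
  have htail : ∀ s, ∫⁻ x, exponentialPDF (x₀ + y₀ + δ * n) x *
        {p : ℝ × ℝ | p.1 ≤ t ∧ t < p.1 + p.2}.indicator 1 (s, x)
      = ENNReal.ofReal (1 / (x₀ + y₀ + δ * n)) * exponentialPDF (x₀ + y₀ + δ * n) (t - s) := by
    intro s
    rcases lt_or_ge t s with hst | hst
    · simp [exponentialPDF_of_neg (sub_neg.2 hst), not_le.2 hst]
    have e1 : ∀ x, exponentialPDF (x₀ + y₀ + δ * n) x *
        {p : ℝ × ℝ | p.1 ≤ t ∧ t < p.1 + p.2}.indicator 1 (s, x)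
        = (Set.Iic (t - s))ᶜ.indicator (exponentialPDF (x₀ + y₀ + δ * n)) x := by
      intro x
      by_cases hx : t - s < x
      · simp [hst, hx, sub_lt_iff_lt_add'.1 hx]
      · have hx' : ¬ t < s + x := fun hc => hx (by linarith)
        simp [hx, hx']
    have e2 := lintegral_add_compl (μ := volume) (exponentialPDF (x₀ + y₀ + δ * n))
      (measurableSet_Iic (a := t - s))
    rw [lintegral_exponentialPDF_eq_one hs, lintegral_exponentialPDF_eq_antiDeriv hs,
      if_pos (sub_nonneg.2 hst)] at e2
    have hle : Real.exp (-((x₀ + y₀ + δ * n) * (t - s))) ≤ 1 :=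
      Real.exp_le_one_iff.2 (neg_nonpos.2 (mul_nonneg hs.le (sub_nonneg.2 hst)))
    have e3 : (1 : ENNReal) = ENNReal.ofReal (1 - Real.exp (-((x₀ + y₀ + δ * n) * (t - s))))
        + ENNReal.ofReal (Real.exp (-((x₀ + y₀ + δ * n) * (t - s)))) := by
      rw [← ENNReal.ofReal_add (by linarith) (by positivity)]
      simp
    rw [lintegral_congr e1, lintegral_indicator measurableSet_Iic.compl,
      (ENNReal.add_right_inj ENNReal.ofReal_ne_top).1 (e2.trans e3),
      exponentialPDF_of_nonneg (sub_nonneg.2 hst), ← ENNReal.ofReal_mul (by positivity)]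
    congr 1
    field_simp
  rw [hsplit, Finset.sum_congr rfl fun i _ => hstep i, ← Finset.sum_mul, hsum, one_mul]
  simp only [htail]
  -- T_0 is deterministic; from T_1 on, the profile describes the law of the renewal time.
  cases n with
  | zero =>
    obtain rfl : k = 0 := by omega
    simp only [colourCount, renewalTime, Finset.range_zero, Finset.sum_empty, if_true,
      lintegral_const, measure_univ, mul_one, Nat.cast_zero, mul_zero, add_zero, sub_zero, pow_zero,
      urnWeight_zero_left, one_mul]
    rw [exponentialPDF_of_nonneg ht, ← ENNReal.ofReal_mul (by positivity)]
    congr 1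
    field_simp
  | succ n =>
    have hconst : ∀ (p : Prop) [Decidable p] (c x : ENNReal),
        (if p then c * x else 0) = c * if p then x else 0 := by
      intro p _ c x
      split_ifs <;> simp
    have hg : Measurable fun x => exponentialPDF (x₀ + y₀ + δ * ↑(n + 1)) (t - x) :=
      (measurable_exponentialPDF _).comp (measurable_const.sub measurable_id)
    have hq := urnWeight_nonneg (p := α / δ) (a := x₀ / α) (b := y₀ / δ) (by positivity)
      ((div_le_one hδ).2 hαδ.le) (by positivity) (by positivity) (n + 1) k
    simp only [hconst]
    rw [lintegral_const_mul' _ _ ENNReal.ofReal_ne_top,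
      h.lintegral_step_of_profile hα hαδ hx₀ hy₀ hxy₀ n hg
        (h.lintegral_exponentialPDF_renewalTime hα hαδ hx₀ hy₀ hxy₀ n hg) k,
      lintegral_yuleProfile_mul_exponentialPDF hxy₀ hδ, yuleProfile, if_pos ht,
      ← ENNReal.ofReal_mul (by positivity), ← ENNReal.ofReal_mul (by positivity),
      ← ENNReal.ofReal_mul (by positivity)]
    congr 1
    field_simp

end IsTriangularRenewalSequence

/-! ### Summation of the exponential moments and non-explosion -/

/-- The exponent is linear in n and k, so its factors e^{δvn} and e^{α(u-v)k} merge into r^n z^k.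
With D and B the two positive quantities, 1 - r = e^{δv} D and 1 - z(1 - (1 - r)^p) = e^{αu} B: the
hypotheses are exactly the convergence conditions. -/
theorem tsum_tsum_urnWeight_mul_exp {α δ x₀ y₀ : ℝ} (hα : 0 < α) (hαδ : α < δ)
    (hx₀ : 0 ≤ x₀) (hy₀ : 0 ≤ y₀) {t : ℝ} (ht : 0 ≤ t) {u v : ℝ}
    (hD : 0 < Real.exp (-δ * v) - 1 + Real.exp (-δ * t))
    (hB : 0 < Real.exp (-α * u) - Real.exp (-α * v)
        + (Real.exp (-δ * v) - 1 + Real.exp (-δ * t)) ^ (α / δ)) :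
    ∑' (n : ℕ) (k : ℕ), ENNReal.ofReal (urnWeight (α / δ) (x₀ / α) (y₀ / δ) n k *
        (Real.exp (-((x₀ + y₀) * t)) * (1 - Real.exp (-(δ * t))) ^ n)) *
        ENNReal.ofReal (Real.exp (u * triangularPosition α δ x₀ y₀ n k 0
          + v * triangularPosition α δ x₀ y₀ n k 1))
      = ENNReal.ofReal (Real.exp (-x₀ * t)
          * (Real.exp (-α * u) - Real.exp (-α * v)
              + (Real.exp (-δ * v) - 1 + Real.exp (-δ * t)) ^ (α / δ)) ^ (-x₀ / α)
          * (Real.exp (-y₀ * t)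
            * (Real.exp (-δ * v) - 1 + Real.exp (-δ * t)) ^ (-y₀ / δ))) := by
  have hδ : 0 < δ := hα.trans hαδ
  set D := Real.exp (-δ * v) - 1 + Real.exp (-δ * t) with hDdef
  set B := Real.exp (-α * u) - Real.exp (-α * v) + D ^ (α / δ) with hBdef
  set r := (1 - Real.exp (-(δ * t))) * Real.exp (δ * v) with hr
  set z := Real.exp (α * (u - v)) with hz
  have hR : 0 ≤ 1 - Real.exp (-(δ * t)) := by
    have : 0 ≤ δ * t := by positivity
    simpa using this
  have hr1 : 1 - r = Real.exp (δ * v) * D := by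
    have : Real.exp (δ * v) * Real.exp (-δ * v) = 1 := by rw [← Real.exp_add]; simp
    rw [hr, hDdef, show -(δ * t) = -δ * t by ring]
    linear_combination -this
  have hrp : (1 - r) ^ (α / δ) = Real.exp (α * v) * D ^ (α / δ) := by
    rw [hr1, Real.mul_rpow (Real.exp_pos _).le hD.le, ← Real.exp_mul]
    congr 2
    field_simp
  have hzB : 1 - z * (1 - (1 - r) ^ (α / δ)) = Real.exp (α * u) * B := by
    have e1 : z = Real.exp (α * u) * Real.exp (-α * v) := by
      rw [hz, ← Real.exp_add]
      congr 1
      ring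
    have e2 : Real.exp (α * u) * Real.exp (-α * u) = 1 := by rw [← Real.exp_add]; simp
    have e3 : Real.exp (-α * v) * Real.exp (α * v) = 1 := by rw [← Real.exp_add]; simp
    rw [hrp, e1, hBdef]
    linear_combination -e2 + Real.exp (α * u) * D ^ (α / δ) * e3
  have hmain := tsum_tsum_urnWeight (p := α / δ) (a := x₀ / α) (b := y₀ / δ) (r := r) (z := z)
    (by positivity) ((div_le_one hδ).2 hαδ.le) (by positivity) (by positivity) (by positivity)
    (by linarith [mul_pos (Real.exp_pos (δ * v)) hD]) (by positivity)
    (by linarith [mul_pos (Real.exp_pos (α * u)) hB])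
  rw [hzB, hr1] at hmain
  have hterm : ∀ n k : ℕ, ENNReal.ofReal (urnWeight (α / δ) (x₀ / α) (y₀ / δ) n k *
        (Real.exp (-((x₀ + y₀) * t)) * (1 - Real.exp (-(δ * t))) ^ n)) *
        ENNReal.ofReal (Real.exp (u * triangularPosition α δ x₀ y₀ n k 0
          + v * triangularPosition α δ x₀ y₀ n k 1))
      = ENNReal.ofReal (Real.exp (-((x₀ + y₀) * t) + u * x₀ + v * y₀)) *
        ENNReal.ofReal (urnWeight (α / δ) (x₀ / α) (y₀ / δ) n k * r ^ n * z ^ k) := by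
    intro n k
    rw [← ENNReal.ofReal_mul' (Real.exp_pos _).le, ← ENNReal.ofReal_mul (Real.exp_pos _).le]
    congr 1
    simp only [triangularPosition, Matrix.cons_val_zero, Matrix.cons_val_one,
      Matrix.cons_val_fin_one]
    have e : Real.exp (-((x₀ + y₀) * t)) * Real.exp (u * (x₀ + α * k) + v * (y₀ + δ * n - α * k))
        = Real.exp (-((x₀ + y₀) * t) + u * x₀ + v * y₀) * (Real.exp (δ * v) ^ n * z ^ k) := by
      rw [hz, ← Real.exp_nat_mul, ← Real.exp_nat_mul, ← Real.exp_add, ← Real.exp_add, ← Real.exp_add]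
      congr 1
      ring
    rw [hr, mul_pow]
    linear_combination (urnWeight (α / δ) (x₀ / α) (y₀ / δ) n k *
      (1 - Real.exp (-(δ * t))) ^ n) * e
  simp_rw [hterm, ENNReal.tsum_mul_left]
  rw [hmain, ← ENNReal.ofReal_mul (Real.exp_pos _).le,
    Real.mul_rpow (Real.exp_pos _).le hD.le, Real.mul_rpow (Real.exp_pos _).le hB.le,
    ← Real.exp_mul, ← Real.exp_mul, neg_div, neg_div]
  congr 1
  have e : Real.exp (-((x₀ + y₀) * t) + u * x₀ + v * y₀) *
      (Real.exp (δ * v * -(y₀ / δ)) * Real.exp (α * u * -(x₀ / α)))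
      = Real.exp (-x₀ * t) * Real.exp (-y₀ * t) := by
    rw [← Real.exp_add, ← Real.exp_add, ← Real.exp_add]
    congr 1
    field_simp
    ring
  linear_combination (D ^ (-(y₀ / δ)) * B ^ (-(x₀ / α))) * e

/-- Nonnegative waiting times make the intervals [T_n, T_{n+1}) disjoint, so only one term survives.
-/
theorem tsum_renewal_count {Ω : Type*} {τ : ℕ → Ω → ℝ} {J : ℕ → Ω → Fin 2} {ω : Ω} (hτ : ∀ n, 0 ≤ τ n ω) {t : ℝ}
    {m : ℕ} (hm : renewalTime τ m ω ≤ t) (hm' : t < renewalTime τ (m + 1) ω) (φ : ℕ → ℕ → ENNReal) :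
    ∑' (n : ℕ) (k : ℕ), (if colourCount J n ω = k ∧ renewalTime τ n ω ≤ t ∧
      t < renewalTime τ (n + 1) ω then (1 : ENNReal) else 0) * φ n k = φ m (colourCount J m ω) := by
  have hmono : Monotone fun n => renewalTime τ n ω := monotone_nat_of_le_succ fun n => by
    rw [renewalTime_succ]
    linarith [hτ n]
  rw [tsum_eq_single m, tsum_eq_single (colourCount J m ω)]
  · simp [hm, hm']
  · intro k hk
    simp [hk.symm]
  · intro n hn
    refine ENNReal.tsum_eq_zero.2 fun k => ?_
    rw [if_neg, zero_mul]
    rintro ⟨-, h1, h2⟩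
    rcases lt_or_gt_of_ne hn with hlt | hlt
    · have := hmono (show n + 1 ≤ m from hlt)
      simp only at this
      linarith
    · have := hmono (show m + 1 ≤ n from hlt)
      simp only at this
      linarith

namespace IsTriangularRenewalSequence

variable {Ω : Type*} [MeasurableSpace Ω] {α δ x₀ y₀ : ℝ} {τ : ℕ → Ω → ℝ} {J : ℕ → Ω → Fin 2}
  {P : Measure Ω}

theorem aemeasurable_renewal_count (h : IsTriangularRenewalSequence α δ x₀ y₀ τ J P)
    (n k : ℕ) (t : ℝ) :
    AEMeasurable (fun ω => if colourCount J n ω = k ∧ renewalTime τ n ω ≤ t ∧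
      t < renewalTime τ (n + 1) ω then (1 : ENNReal) else 0) P := by
  have hm : Measurable fun p : ℕ × ℝ × ℝ =>
      if p.1 = k ∧ p.2.1 ≤ t ∧ t < p.2.2 then (1 : ENNReal) else 0 := by
    refine Measurable.ite (MeasurableSet.inter (measurable_fst (measurableSet_singleton k))
      (MeasurableSet.inter ?_ ?_)) measurable_const measurable_const
    · exact measurableSet_le (measurable_fst.comp measurable_snd) measurable_const
    · exact measurableSet_lt measurable_const (measurable_snd.comp measurable_snd)
  exact hm.comp_aemeasurable ((h.aemeasurable_colourCount n).prodMk
    ((h.aemeasurable_renewalTime n).prodMk (h.aemeasurable_renewalTime (n + 1))))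

/-- The indicators of the pairs (n, k) add up to at most 1 almost surely, and their integral is the
series at u = v = 0, which equals 1; hence the sum is 1 almost surely. -/
theorem ae_exists_renewal [IsProbabilityMeasure P]
    (h : IsTriangularRenewalSequence α δ x₀ y₀ τ J P) (hα : 0 < α) (hαδ : α < δ)
    (hx₀ : 0 ≤ x₀) (hy₀ : 0 ≤ y₀) (hxy₀ : 0 < x₀ + y₀) {t : ℝ} (ht : 0 ≤ t) :
    ∀ᵐ ω ∂P, ∃ m, renewalTime τ m ω ≤ t ∧ t < renewalTime τ (m + 1) ω := by
  have hδ : 0 < δ := hα.trans hαδ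
  set F : Ω → ENNReal := fun ω => ∑' (n : ℕ) (k : ℕ), (if colourCount J n ω = k ∧
    renewalTime τ n ω ≤ t ∧ t < renewalTime τ (n + 1) ω then (1 : ENNReal) else 0) with hF
  have hFm : AEMeasurable F P :=
    AEMeasurable.tsum fun n => AEMeasurable.tsum fun k =>
      h.aemeasurable_renewal_count n k t
  have hzero : ∀ ω, (¬ ∃ m, renewalTime τ m ω ≤ t ∧ t < renewalTime τ (m + 1) ω) → F ω = 0 := by
    intro ω hω
    refine ENNReal.tsum_eq_zero.2 fun n => ENNReal.tsum_eq_zero.2 fun k => if_neg ?_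
    exact fun hc => hω ⟨n, hc.2⟩
  have hle : ∀ᵐ ω ∂P, F ω ≤ 1 := by
    filter_upwards [h.ae_waiting_nonneg] with ω hτ
    by_cases hω : ∃ m, renewalTime τ m ω ≤ t ∧ t < renewalTime τ (m + 1) ω
    · obtain ⟨m, hm, hm'⟩ := hω
      have := tsum_renewal_count (J := J) hτ hm hm' fun _ _ => 1
      simp only [mul_one] at this
      exact this.le
    · rw [hzero ω hω]
      exact zero_le_one
  have hint : ∫⁻ ω, F ω ∂P = 1 := by
    rw [hF, lintegral_tsum fun n => AEMeasurable.tsum fun k =>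
      h.aemeasurable_renewal_count n k t]
    simp_rw [lintegral_tsum fun k => h.aemeasurable_renewal_count _ k t,
      h.lintegral_renewal_count hα hαδ hx₀ hy₀ hxy₀ _ _ ht]
    have hsum := tsum_tsum_urnWeight_mul_exp hα hαδ hx₀ hy₀ ht (u := 0) (v := 0)
      (by simpa using Real.exp_pos _) (by simpa using Real.rpow_pos_of_pos (Real.exp_pos _) _)
    simp only [zero_mul, add_zero, Real.exp_zero, ENNReal.ofReal_one, mul_one, mul_zero, sub_self,
      zero_add, ← Real.exp_mul, ← Real.exp_add] at hsum
    rw [hsum, show -x₀ * t + -δ * t * (α / δ) * (-x₀ / α) + (-y₀ * t + -δ * t * (-y₀ / δ)) = 0 by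
      field_simp
      ring]
    simp
  have hae : F =ᵐ[P] fun _ => 1 :=
    ae_eq_of_ae_le_of_lintegral_le hle (by simp [hint]) aemeasurable_const (by simp [hint])
  filter_upwards [hae] with ω hω
  by_contra hc
  rw [hzero ω hc] at hω
  exact zero_ne_one hω

end IsTriangularRenewalSequence

/-! ### Law of the walk at time t and its moment generating function -/

/-- W t almost surely takes countably many values, each on a null-measurable event, so φ needs no
measurability and that of φ(W t) is a conclusion. -/
theorem IsContinuumPolyaWalk.lintegral_eq_tsum {Ω : Type*} [MeasurableSpace Ω] {P : Measure Ω}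
    [IsProbabilityMeasure P] {α δ x₀ y₀ : ℝ} (hα : 0 < α) (hαδ : α < δ)
    (hx₀ : 0 ≤ x₀) (hy₀ : 0 ≤ y₀) (hxy₀ : 0 < x₀ + y₀) {W : ℝ → Ω → Fin 2 → ℝ}
    (hW : IsContinuumPolyaWalk !![α, δ - α; 0, δ] ![x₀, y₀] W P) {t : ℝ} (ht : 0 ≤ t)
    (φ : (Fin 2 → ℝ) → ENNReal) :
    AEMeasurable (fun ω => φ (W t ω)) P ∧
    ∫⁻ ω, φ (W t ω) ∂P = ∑' (n : ℕ) (k : ℕ),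
      ENNReal.ofReal (urnWeight (α / δ) (x₀ / α) (y₀ / δ) n k *
        (Real.exp (-((x₀ + y₀) * t)) * (1 - Real.exp (-(δ * t))) ^ n)) *
        φ (triangularPosition α δ x₀ y₀ n k) := by
  obtain ⟨τ, J, hcond, hpath⟩ := hW
  have h : IsTriangularRenewalSequence α δ x₀ y₀ τ J P := hcond
  have hae : (fun ω => φ (W t ω)) =ᵐ[P] fun ω => ∑' (n : ℕ) (k : ℕ),
      (if colourCount J n ω = k ∧ renewalTime τ n ω ≤ t ∧ t < renewalTime τ (n + 1) ω
        then (1 : ENNReal) else 0) * φ (triangularPosition α δ x₀ y₀ n k) := by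
    filter_upwards [hpath, h.ae_waiting_nonneg,
      h.ae_exists_renewal hα hαδ hx₀ hy₀ hxy₀ ht] with ω hω hτ ⟨m, hm, hm'⟩
    rw [tsum_renewal_count hτ hm hm', hω m t hm hm',
      walkPosition_eq_colourCount]
  have hm : ∀ n k, AEMeasurable (fun ω => (if colourCount J n ω = k ∧ renewalTime τ n ω ≤ t ∧
      t < renewalTime τ (n + 1) ω then (1 : ENNReal) else 0) *
        φ (triangularPosition α δ x₀ y₀ n k)) P :=
    fun n k => (h.aemeasurable_renewal_count n k t).mul_const _
  refine ⟨(AEMeasurable.tsum fun n => AEMeasurable.tsum (hm n)).congr hae.symm, ?_⟩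
  rw [lintegral_congr_ae hae, lintegral_tsum fun n => AEMeasurable.tsum (hm n)]
  refine tsum_congr fun n => ?_
  rw [lintegral_tsum (hm n)]
  refine tsum_congr fun k => ?_
  rw [lintegral_mul_const'' _ (h.aemeasurable_renewal_count n k t),
    h.lintegral_renewal_count hα hαδ hx₀ hy₀ hxy₀ n k ht]

theorem IsContinuumPolyaWalk.integrable_exp_and_integral_exp {Ω : Type*} [MeasurableSpace Ω]
    {P : Measure Ω} [IsProbabilityMeasure P] {α δ x₀ y₀ : ℝ} (hα : 0 < α) (hαδ : α < δ)
    (hx₀ : 0 ≤ x₀) (hy₀ : 0 ≤ y₀) (hxy₀ : 0 < x₀ + y₀) {W : ℝ → Ω → Fin 2 → ℝ}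
    (hW : IsContinuumPolyaWalk !![α, δ - α; 0, δ] ![x₀, y₀] W P) {t : ℝ} (ht : 0 ≤ t) {u v : ℝ}
    (hD : 0 < Real.exp (-δ * v) - 1 + Real.exp (-δ * t))
    (hB : 0 < Real.exp (-α * u) - Real.exp (-α * v)
        + (Real.exp (-δ * v) - 1 + Real.exp (-δ * t)) ^ (α / δ)) :
    Integrable (fun ω => Real.exp (u * W t ω 0 + v * W t ω 1)) P ∧
      ∫ ω, Real.exp (u * W t ω 0 + v * W t ω 1) ∂P
        = Real.exp (-x₀ * t)
          * (Real.exp (-α * u) - Real.exp (-α * v)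
              + (Real.exp (-δ * v) - 1 + Real.exp (-δ * t)) ^ (α / δ)) ^ (-x₀ / α)
          * (Real.exp (-y₀ * t)
            * (Real.exp (-δ * v) - 1 + Real.exp (-δ * t)) ^ (-y₀ / δ)) := by
  obtain ⟨hm, hint⟩ := hW.lintegral_eq_tsum hα hαδ hx₀ hy₀ hxy₀ ht
    fun w => ENNReal.ofReal (Real.exp (u * w 0 + v * w 1))
  rw [tsum_tsum_urnWeight_mul_exp hα hαδ hx₀ hy₀ ht hD hB] at hint
  have hm' : AEStronglyMeasurable (fun ω => Real.exp (u * W t ω 0 + v * W t ω 1)) P := by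
    have := hm.ennreal_toReal
    simp only [ENNReal.toReal_ofReal (Real.exp_pos _).le] at this
    exact this.aestronglyMeasurable
  have hnn : 0 ≤ᵐ[P] fun ω => Real.exp (u * W t ω 0 + v * W t ω 1) :=
    ae_of_all _ fun ω => (Real.exp_pos _).le
  refine ⟨⟨hm', ?_⟩, ?_⟩
  · rw [hasFiniteIntegral_iff_ofReal hnn, hint]
    exact ENNReal.ofReal_lt_top
  · rw [integral_eq_lintegral_of_nonneg_ae hnn hm', hint, ENNReal.toReal_ofReal (by positivity)]

/-! ### First and second moments -/

/-- Mean and variance are the first two derivatives of the cumulant generating function at 0; the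
logarithm turns the product formula into a sum. -/
theorem moments_of_hasDerivAt_cgf {Ω : Type*} [MeasurableSpace Ω] {P : Measure Ω}
    [IsProbabilityMeasure P] {Z : Ω → ℝ} {L L' : ℝ → ℝ} {L'' : ℝ}
    (hint : ∀ᶠ θ in nhds 0, Integrable (fun ω => Real.exp (θ * Z ω)) P)
    (hcgf : cgf Z P =ᶠ[nhds 0] L) (hL : ∀ᶠ θ in nhds 0, HasDerivAt L (L' θ) θ)
    (hL' : HasDerivAt L' L'' 0) :
    MemLp Z 2 P ∧ ∫ ω, Z ω ∂P = L' 0 ∧ ∫ ω, Z ω ^ 2 ∂P = L' 0 ^ 2 + L'' := by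
  have hmem : (0 : ℝ) ∈ interior (integrableExpSet Z P) := mem_interior_iff_mem_nhds.2 hint
  have hderiv : deriv (cgf Z P) =ᶠ[nhds 0] L' :=
    hcgf.deriv.trans (hL.mono fun θ hθ => hθ.deriv)
  have h1 := deriv_cgf_zero hmem
  have h2 := iteratedDeriv_two_cgf hmem
  rw [iteratedDeriv_succ, iteratedDeriv_one, hderiv.deriv_eq, hL'.deriv, hderiv.eq_of_nhds] at h2
  rw [hderiv.eq_of_nhds] at h1
  simp only [probReal_univ, div_one] at h1
  simp only [zero_mul, Real.exp_zero, mul_one, mgf_zero, div_one] at h2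
  exact ⟨memLp_of_mem_interior_integrableExpSet hmem 2, h1.symm, by linarith⟩

theorem IsContinuumPolyaWalk.moments_linear_combination {Ω : Type*} [MeasurableSpace Ω]
    {P : Measure Ω} [IsProbabilityMeasure P] {α δ x₀ y₀ : ℝ} (hα : 0 < α) (hαδ : α < δ)
    (hx₀ : 0 ≤ x₀) (hy₀ : 0 ≤ y₀) (hxy₀ : 0 < x₀ + y₀) {W : ℝ → Ω → Fin 2 → ℝ}
    (hW : IsContinuumPolyaWalk !![α, δ - α; 0, δ] ![x₀, y₀] W P) {t : ℝ} (ht : 0 ≤ t) (i j : ℝ) :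
    MemLp (fun ω => i * W t ω 0 + j * W t ω 1) 2 P ∧
    ∫ ω, (i * W t ω 0 + j * W t ω 1) ∂P
      = x₀ * (i - j) * Real.exp (α * t) + (x₀ + y₀) * j * Real.exp (δ * t) ∧
    ∫ ω, (i * W t ω 0 + j * W t ω 1) ^ 2 ∂P
      = (x₀ * (i - j) * Real.exp (α * t) + (x₀ + y₀) * j * Real.exp (δ * t)) ^ 2
        + (-x₀ * (α * (i ^ 2 - j ^ 2) * Real.exp (α * t) + δ * j ^ 2 * Real.exp (δ * t)
            + (α - δ) * j ^ 2 * Real.exp (δ * t) ^ 2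
            - α * ((i - j) * Real.exp (α * t) + j * Real.exp (δ * t)) ^ 2)
          - y₀ * δ * j ^ 2 * (Real.exp (δ * t) - Real.exp (δ * t) ^ 2)) := by
  have hδ : 0 < δ := hα.trans hαδ
  -- D and B are the two bases of the formula along the line (u, v) = (iθ, jθ); D₁ and B₁ are their
  -- derivatives.
  set D : ℝ → ℝ := fun θ => Real.exp (-δ * (j * θ)) - 1 + Real.exp (-δ * t) with hD
  set D₁ : ℝ → ℝ := fun θ => -δ * j * Real.exp (-δ * (j * θ)) with hD₁
  set B : ℝ → ℝ := fun θ => Real.exp (-α * (i * θ)) - Real.exp (-α * (j * θ)) + D θ ^ (α / δ) with hB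
  set B₁ : ℝ → ℝ := fun θ => -α * i * Real.exp (-α * (i * θ)) + α * j * Real.exp (-α * (j * θ))
    + D₁ θ * (α / δ) * D θ ^ (α / δ - 1) with hB₁
  have hexp : ∀ c d θ : ℝ, HasDerivAt (fun θ => Real.exp (c * (d * θ)))
      (c * d * Real.exp (c * (d * θ))) θ := fun c d θ => by
    refine ((((hasDerivAt_id θ).const_mul d).const_mul c).exp).congr_deriv ?_
    simp only [id]
    ring
  have hD' : ∀ θ, HasDerivAt D (D₁ θ) θ := fun θ => ((hexp (-δ) j θ).sub_const 1).add_const _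
  have hD₁' : ∀ θ, HasDerivAt D₁ (-δ * j * (-δ * j * Real.exp (-δ * (j * θ)))) θ :=
    fun θ => (hexp (-δ) j θ).const_mul (-δ * j)
  have hB' : ∀ θ, 0 < D θ → HasDerivAt B (B₁ θ) θ := fun θ hθ => by
    refine (((hexp (-α) i θ).sub (hexp (-α) j θ)).add
      ((hD' θ).rpow_const (p := α / δ) (Or.inl hθ.ne'))).congr_deriv ?_
    simp only [hB₁]
    ring
  have hD0 : D 0 = Real.exp (-δ * t) := by simp [hD]
  have hDp0 : D 0 ^ (α / δ) = Real.exp (-α * t) := by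
    rw [hD0, ← Real.exp_mul]
    congr 1
    field_simp
  have hB0 : B 0 = Real.exp (-α * t) := by simp [hB, hDp0]
  have hD0pos : 0 < D 0 := hD0 ▸ Real.exp_pos _
  have hB0pos : 0 < B 0 := hB0 ▸ Real.exp_pos _
  have hDev : ∀ᶠ θ in nhds 0, 0 < D θ := (hD' 0).continuousAt.eventually (lt_mem_nhds hD0pos)
  have hBev : ∀ᶠ θ in nhds 0, 0 < B θ :=
    (hB' 0 hD0pos).continuousAt.eventually (lt_mem_nhds hB0pos)
  have hmgf : ∀ θ, 0 < D θ → 0 < B θ →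
      Integrable (fun ω => Real.exp (θ * (i * W t ω 0 + j * W t ω 1))) P ∧
      ∫ ω, Real.exp (θ * (i * W t ω 0 + j * W t ω 1)) ∂P
        = Real.exp (-x₀ * t) * B θ ^ (-x₀ / α) * (Real.exp (-y₀ * t) * D θ ^ (-y₀ / δ)) := by
    intro θ hθ hθ'
    have e : ∀ ω, θ * (i * W t ω 0 + j * W t ω 1) = i * θ * W t ω 0 + j * θ * W t ω 1 :=
      fun ω => by ring
    simp_rw [e]
    exact hW.integrable_exp_and_integral_exp hα hαδ hx₀ hy₀ hxy₀ ht hθ hθ'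
  have hcgf : cgf (fun ω => i * W t ω 0 + j * W t ω 1) P =ᶠ[nhds 0] fun θ =>
      -x₀ * t + -y₀ * t + (-x₀ / α) * Real.log (B θ) + (-y₀ / δ) * Real.log (D θ) := by
    filter_upwards [hDev, hBev] with θ hθ hθ'
    rw [cgf, mgf, (hmgf θ hθ hθ').2, Real.log_mul (by positivity) (by positivity),
      Real.log_mul (by positivity) (by positivity), Real.log_mul (by positivity) (by positivity),
      Real.log_exp, Real.log_exp, Real.log_rpow hθ', Real.log_rpow hθ]
    ring
  have hL : ∀ᶠ θ in nhds 0, HasDerivAt (fun θ => -x₀ * t + -y₀ * t + (-x₀ / α) * Real.log (B θ)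
      + (-y₀ / δ) * Real.log (D θ)) ((-x₀ / α) * (B₁ θ / B θ) + (-y₀ / δ) * (D₁ θ / D θ)) θ := by
    filter_upwards [hDev, hBev] with θ hθ hθ'
    exact ((((hB' θ hθ).log hθ'.ne').const_mul (-x₀ / α)).const_add _).add
      (((hD' θ).log hθ.ne').const_mul (-y₀ / δ))
  have hB₁' := ((hexp (-α) i 0).const_mul (-α * i)).add ((hexp (-α) j 0).const_mul (α * j)) |>.add
    (((hD₁' 0).mul_const (α / δ)).mul
      ((hD' 0).rpow_const (p := α / δ - 1) (Or.inl hD0pos.ne')))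
  have hL' := ((hB₁'.div (hB' 0 hD0pos) hB0pos.ne').const_mul (-x₀ / α)).add
    (((hD₁' 0).div (hD' 0) hD0pos.ne').const_mul (-y₀ / δ))
  have hmain := moments_of_hasDerivAt_cgf
    ((hDev.and hBev).mono fun θ hθ => (hmgf θ hθ.1 hθ.2).1) hcgf hL hL'
  -- All values at θ = 0 are rewritten as rational expressions in e^{αt} and e^{δt}, so that the
  -- claim becomes algebraic.
  have hE : Real.exp (-δ * t) = (Real.exp (δ * t))⁻¹ := by rw [← Real.exp_neg, neg_mul]
  have hA : Real.exp (-α * t) = (Real.exp (α * t))⁻¹ := by rw [← Real.exp_neg, neg_mul]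
  have hp1 : D 0 ^ (α / δ - 1) = Real.exp (δ * t) / Real.exp (α * t) := by
    rw [Real.rpow_sub_one hD0pos.ne', hDp0, hD0, hE, hA]
    field_simp
  have hp2 : D 0 ^ (α / δ - 1 - 1) = Real.exp (δ * t) ^ 2 / Real.exp (α * t) := by
    rw [Real.rpow_sub_one hD0pos.ne', hp1, hD0, hE]
    field_simp
  have hD₁0 : D₁ 0 = -δ * j := by simp [hD₁]
  have hB₁0 : B₁ 0 = -α * i + α * j + -δ * j * (α / δ) * (Real.exp (δ * t) / Real.exp (α * t)) := by
    simp only [hB₁, hp1, hD₁0]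
    simp
  have hL'0 : (-x₀ / α) * (B₁ 0 / B 0) + (-y₀ / δ) * (D₁ 0 / D 0)
      = x₀ * (i - j) * Real.exp (α * t) + (x₀ + y₀) * j * Real.exp (δ * t) := by
    rw [hB₁0, hB0, hD₁0, hD0, hE, hA]
    field_simp
    ring
  refine ⟨hmain.1, hmain.2.1.trans hL'0, hmain.2.2.trans ?_⟩
  rw [hL'0]
  congr 1
  simp only [Pi.add_apply, Pi.mul_apply, hp1, hp2]
  simp only [hD₁0, hB₁0, hB0, hD0, hE, hA, mul_zero,
    Real.exp_zero, mul_one]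
  field_simp
  ring

theorem theorem3 {Ω : Type*} [MeasurableSpace Ω] (P : Measure Ω) [IsProbabilityMeasure P]
    (α δ x₀ y₀ : ℝ) (hα : 0 < α) (hαδ : α < δ)
    (hx₀ : 0 ≤ x₀) (hy₀ : 0 ≤ y₀) (hxy₀ : 0 < x₀ + y₀)
    (W : ℝ → Ω → Fin 2 → ℝ)
    (hW : IsContinuumPolyaWalk !![α, δ - α; 0, δ] ![x₀, y₀] W P)
    (t : ℝ) (ht : 0 ≤ t) :
    -- the moment generating function
    (∀ u v : ℝ,
      0 < Real.exp (-δ * v) - 1 + Real.exp (-δ * t) →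
      0 < Real.exp (-α * u) - Real.exp (-α * v)
        + (Real.exp (-δ * v) - 1 + Real.exp (-δ * t)) ^ (α / δ) →
      Integrable (fun ω => Real.exp (u * W t ω 0 + v * W t ω 1)) P ∧
      ∫ ω, Real.exp (u * W t ω 0 + v * W t ω 1) ∂P
        = Real.exp (-x₀ * t)
          * (Real.exp (-α * u) - Real.exp (-α * v)
              + (Real.exp (-δ * v) - 1 + Real.exp (-δ * t)) ^ (α / δ)) ^ (-x₀ / α)
          * (Real.exp (-y₀ * t)
            * (Real.exp (-δ * v) - 1 + Real.exp (-δ * t)) ^ (-y₀ / δ))) ∧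
    -- the first and second moments
    (MemLp (fun ω => W t ω 0) 2 P ∧ MemLp (fun ω => W t ω 1) 2 P ∧
      ∫ ω, W t ω 0 ∂P = x₀ * Real.exp (α * t) ∧
      ∫ ω, W t ω 1 ∂P = (x₀ + y₀) * Real.exp (δ * t) - x₀ * Real.exp (α * t) ∧
      ∫ ω, W t ω 0 ^ 2 ∂P
        = x₀ * (α + x₀) * Real.exp (2 * α * t) - α * x₀ * Real.exp (α * t) ∧
      ∫ ω, W t ω 0 * W t ω 1 ∂P
        = x₀ * (α + x₀ + y₀) * Real.exp ((α + δ) * t)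
          - x₀ * (α + x₀) * Real.exp (2 * α * t) ∧
      ∫ ω, W t ω 1 ^ 2 ∂P
        = (x₀ + y₀) * (δ + x₀ + y₀) * Real.exp (2 * δ * t)
          - 2 * x₀ * (α + x₀ + y₀) * Real.exp ((α + δ) * t)
          - δ * (x₀ + y₀) * Real.exp (δ * t)
          + x₀ * (α + x₀) * Real.exp (2 * α * t)
          + α * x₀ * Real.exp (α * t)) := by
  refine ⟨fun u v hD hB => hW.integrable_exp_and_integral_exp hα hαδ hx₀ hy₀ hxy₀ ht hD hB, ?_⟩
  have hX := hW.moments_linear_combination hα hαδ hx₀ hy₀ hxy₀ ht 1 0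
  have hY := hW.moments_linear_combination hα hαδ hx₀ hy₀ hxy₀ ht 0 1
  have hXY := (hW.moments_linear_combination hα hαδ hx₀ hy₀ hxy₀ ht 1 1).2.2
  simp only [one_mul, zero_mul, zero_add, add_zero] at hX hY hXY
  -- Polarization: the mixed moment follows from the second moments of X, Y and X + Y.
  have hsq : ∫ ω, (W t ω 0 + W t ω 1) ^ 2 ∂P
      = ∫ ω, W t ω 0 ^ 2 ∂P + 2 * ∫ ω, W t ω 0 * W t ω 1 ∂P + ∫ ω, W t ω 1 ^ 2 ∂P := by
    have h1 := hX.1.integrable_sq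
    have h2 := hY.1.integrable_sq
    have h3 : Integrable (fun ω => 2 * (W t ω 0 * W t ω 1)) P :=
      (hX.1.integrable_mul hY.1).const_mul 2
    calc ∫ ω, (W t ω 0 + W t ω 1) ^ 2 ∂P
        = ∫ ω, ((W t ω 0 ^ 2 + 2 * (W t ω 0 * W t ω 1)) + W t ω 1 ^ 2) ∂P := by
          congr with ω
          ring
      _ = ∫ ω, (W t ω 0 ^ 2 + 2 * (W t ω 0 * W t ω 1)) ∂P + ∫ ω, W t ω 1 ^ 2 ∂P :=
          integral_add (h1.add h3) h2
      _ = _ := by rw [integral_add h1 h3, integral_const_mul]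
  have hα2 : Real.exp (2 * α * t) = Real.exp (α * t) ^ 2 := by
    rw [← Real.exp_nat_mul]
    congr 1
    push_cast
    ring
  have hδ2 : Real.exp (2 * δ * t) = Real.exp (δ * t) ^ 2 := by
    rw [← Real.exp_nat_mul]
    congr 1
    push_cast
    ring
  have hαδ2 : Real.exp ((α + δ) * t) = Real.exp (α * t) * Real.exp (δ * t) := by
    rw [← Real.exp_add]
    congr 1
    ring
  rw [hα2, hδ2, hαδ2]
  refine ⟨hX.1, hY.1, ?_, ?_, ?_, ?_, ?_⟩
  · rw [hX.2.1]
    ring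
  · rw [hY.2.1]
    ring
  · rw [hX.2.2]
    ring
  · rw [hXY, hX.2.2, hY.2.2] at hsq
    linear_combination -hsq / 2
  · rw [hY.2.2]
    ring
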